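/- A \emph{standard multigraph} $G$ is a finite loopless multigraph in which any two distinct vertices $x,y$ are joined by $\mu(xy)\le 2$ edges. The pair $xy$ is a \emph{light edge} if $\mu(xy)=1$ and a \emph{heavy edge} if $\mu(xy)=2$. Write $e(G)$ for the total number of edges (counted with multiplicity), $e_2(G)$ for the number of heavy edges, $\delta(G)$ for the minimum degree (degrees counted with multiplicity), and $G[S]$ for the submultigraph induced by $S\subseteq V(G)$. For $r\in\mathbb N$ and $\gamma>0$, a standard multigraph $G$ on $n$ vertices is \emph{$(1/r,\gamma)$-extremal} if there is $S\subseteq V(G)$ such that either $\bigl||S|-n/r\bigr|<\gamma n$ and $e(G[S])<\gamma n^2$, or $\bigl||S|-2n/r\bigr|<\gamma n$ and $e_2(G[S])<\gamma n^2$. Let $\mathcal K'_r$ be the family of standard multigraphs obtained from the complete standard multigraph on $r$ vertices (every pair of distinct vertices is a heavy edge) by removing one copy of each edge of some vertex-disjoint paths $P_1,\dots,P_t$ ($t\ge 0$) with $|P_1|\ge\dots\ge|P_t|$, where $|P_i|$ is the number of vertices of $P_i$ and either $|P_1|\le 4$ and $|P_i|\le 2$ for all $i\ge 2$, or $|P_1|,|P_2|\le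 3$ and $|P_i|\le 2$ for all $i\ge 3$. For a family $\mathcal X$ of standard multigraphs, a \emph{perfect $\mathcal X$-tiling} in $G$ is a collection of vertex-disjoint (not necessarily induced) copies in $G$ of elements of $\mathcal X$ that together cover all vertices of $G$. \textbf{Proposition.} There are strictly increasing functions $f,g,h\colon(0,\infty)\to(0,\infty)$ such that the following holds for all integers $r\ge 2$, $n\ge 1$ and reals $\eta,\gamma>0$ with $\gamma\le f(1/r)$, $\eta\le g(\gamma)$ and $1/n\le h(\eta)$ (that is, $0<1/n\ll\eta\ll\gamma\ll 1/r$). If $G$ is a standard multigraph on $n$ vertices that is not $(1/r,\gamma)$-extremal and satisfies $$\delta(G)\ge 2\left(1-\frac1r-\eta\right)n,$$ then $G$ contains a perfect $(\mathcal K'_r\cup\mathcal K'_{r+1})$-tiling. -/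

import Mathlib

/-- A standard multigraph on the vertex set `V`: a loopless multigraph in which any two vertices
are joined by at most two edges.  `mu x y` is the number of edges between `x` and `y`. -/
@[ext]
structure StdMultigraph (V : Type*) where
  mu : V → V → ℕ
  symm : ∀ x y, mu x y = mu y x
  loopless : ∀ x, mu x x = 0
  le_two : ∀ x y, mu x y ≤ 2

namespace StdMultigraph

variable {V : Type*}

/-- The multiplicity as a function of the unordered pair. -/
def muSym (G : StdMultigraph V) : Sym2 V → ℕ :=
  Sym2.lift ⟨G.mu, G.symm⟩

/-- The degree of `v`: the number of edges incident with `v`, counted with multiplicity. -/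
def degree [Fintype V] (G : StdMultigraph V) (v : V) : ℕ :=
  ∑ u, G.mu v u

/-- The minimum degree `δ(G)` (with value `0` if there are no vertices). -/
noncomputable def minDegree [Fintype V] (G : StdMultigraph V) : ℕ :=
  ⨅ v, G.degree v

open Classical in
/-- `e(G)`: the total number of edges, counted with multiplicity. -/
noncomputable def edgeCount [Fintype V] (G : StdMultigraph V) : ℕ :=
  ∑ p : Sym2 V, G.muSym p

open Classical in
/-- `e₂(G)`: the number of heavy edges, i.e. of pairs of vertices joined by two edges. -/
noncomputable def heavyCount [Fintype V] (G : StdMultigraph V) : ℕ :=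
  (Finset.univ.filter fun p : Sym2 V => G.muSym p = 2).card

/-- `G[S]`: the submultigraph induced by `S`. -/
def induce (G : StdMultigraph V) (S : Finset V) : StdMultigraph S where
  mu x y := G.mu x y
  symm x y := G.symm x y
  loopless x := G.loopless x
  le_two x y := G.le_two x y

/-- `G` is `(1/r, γ)`-extremal. -/
def IsExtremal [Fintype V] (G : StdMultigraph V) (r : ℕ) (γ : ℝ) : Prop :=
  (∃ S : Finset V,
      |(S.card : ℝ) - (Fintype.card V : ℝ) / r| < γ * (Fintype.card V : ℝ) ∧
      ((G.induce S).edgeCount : ℝ) < γ * (Fintype.card V : ℝ) ^ 2) ∨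
  (∃ S : Finset V,
      |(S.card : ℝ) - 2 * (Fintype.card V : ℝ) / r| < γ * (Fintype.card V : ℝ) ∧
      ((G.induce S).heavyCount : ℝ) < γ * (Fintype.card V : ℝ) ^ 2)

/-- `xy` is an edge of the path whose vertices, in order, are the entries of `P`. -/
def IsPathEdge (P : List V) (x y : V) : Prop :=
  [x, y] <:+: P ∨ [y, x] <:+: P

open Classical in
/-- The complete standard multigraph on `V` (all pairs of distinct vertices joined by two edges)
with one copy of each edge of the (light) paths `P 0, …, P (t - 1)` removed. -/
noncomputable def completeMinusPaths {t : ℕ} (P : Fin t → List V) : StdMultigraph V where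
  mu x y := if x = y then 0 else if ∃ i, IsPathEdge (P i) x y then 1 else 2
  symm x y := by
    have h : (∃ i, IsPathEdge (P i) x y) ↔ ∃ i, IsPathEdge (P i) y x :=
      exists_congr fun _ => or_comm
    by_cases hxy : x = y
    · simp [hxy]
    · simp [hxy, Ne.symm hxy, h]
  loopless x := by simp
  le_two x y := by split_ifs <;> omega

/-- Standard multigraphs of arbitrary finite order, on the vertex sets `Fin m`. -/
abbrev Finitary : Type := Σ m : ℕ, StdMultigraph (Fin m)

/-- The family `𝒦'_r`: multigraphs obtained from the complete standard multigraph on `r` vertices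
by removing the edges of vertex-disjoint light paths `P 0, P 1, …` with non-increasing numbers of
vertices, where either `|P 0| ≤ 4` and `|P i| ≤ 2` for all other `i`, or
`|P 0|, |P 1| ≤ 3` and `|P i| ≤ 2` for all other `i`. -/
def KPrime (r : ℕ) : Set Finitary :=
  {K | ∃ (t : ℕ) (P : Fin t → List (Fin r)),
    (∀ i, P i ≠ []) ∧
    (∀ i, (P i).Nodup) ∧
    (∀ i j, i ≠ j → (P i).Disjoint (P j)) ∧
    (∀ i j, i ≤ j → (P j).length ≤ (P i).length) ∧
    ((∀ i, (P i).length ≤ if (i : ℕ) = 0 then 4 else 2) ∨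
      (∀ i, (P i).length ≤ if (i : ℕ) < 2 then 3 else 2)) ∧
    K = ⟨r, completeMinusPaths P⟩}

/-- A copy in `G` of an element of the family `X`: a (not necessarily induced) submultigraph
of `G` that is isomorphic to an element of `X`, given by an embedding. -/
structure Tile (X : Set Finitary) (G : StdMultigraph V) where
  shape : Finitary
  mem : shape ∈ X
  emb : Fin shape.1 ↪ V
  le : ∀ x y, shape.2.mu x y ≤ G.mu (emb x) (emb y)

/-- The vertex set of a tile. -/
def Tile.verts {X : Set Finitary} {G : StdMultigraph V} (T : Tile X G) : Set V :=
  Set.range T.emb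

/-- An `X`-tiling in `G`: a collection of vertex-disjoint copies of elements of `X`. -/
def IsTiling (X : Set Finitary) (G : StdMultigraph V) (𝒯 : Set (Tile X G)) : Prop :=
  𝒯.PairwiseDisjoint Tile.verts

/-- `G` contains a perfect `X`-tiling, i.e. an `X`-tiling covering all vertices of `G`. -/
def HasPerfectTiling (X : Set Finitary) (G : StdMultigraph V) : Prop :=
  ∃ 𝒯 : Set (Tile X G), IsTiling X G 𝒯 ∧ ∀ v, ∃ T ∈ 𝒯, v ∈ T.verts

end StdMultigraph

/-! Measure a pair by its defect, the number of edges it lacks from being heavy, with defect 2 from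
a vertex to itself. The degree condition then says that every vertex has total defect at most `2 *
(1 / r + η) * n`. Hence in a partition into `r`-cliques a vertex has average defect about 2 to a
clique. Defect at most 1 is what permits a vertex to be added. The building blocks are near-full
cliques, whose light edges form a matching. Adding one vertex of defect at most 1 extends one light
edge to a path on three vertices. Adding two such vertices gives one path on four or two on three,
which are exactly the shapes allowed in `KPrime`, unless both are light to the same matched vertex.

Almost covering (`exists_almost_tiling`): take disjoint near-full cliques of order at most `r` with
exponentially weighted sizes maximal. If many vertices lay in cliques of order below `r`, these
cliques would have too much defect, since small total defect to another clique yields an improving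
exchange (`IsNearFull.exists_exchange`, `IsOptimal.card_small_defect_le`). No extremality assumption
is needed here.

Absorbing (`IsTightFamily.absorbs`): an uncovered vertex `v` is inserted along a chain of at most
three cliques, each passing one vertex to the next, or by exchanging vertices of two cliques. If all
this fails, `v` and its non-heavy neighbours in almost all cliques have defect exactly 2 to almost
every clique. The exchange argument `IsTightFamily.defect_le_of_not_absorbs` then forces these
neighbours to have nearly the same defects as `v`. By `isExtremal_of_uniform` the non-neighbours of
`v` are nearly independent of size about `n/r`, or its light neighbours span few heavy edges and
number about `2n/r`, so the multigraph is extremal.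

Since only a small proportion of vertices is uncovered, the absorption can be repeated on unused
cliques (`IsTightFamily.absorb_all`). -/

namespace StdMultigraph

/-! ### Defects and near-full cliques. -/

section Basics

variable {V : Type*} (G : StdMultigraph V)

/-- The defect of a pair: the number of edges missing from a heavy edge. -/
def defect (x y : V) : ℕ := 2 - G.mu x y

/-- The total defect from a vertex to a set. -/
def defectTo (x : V) (T : Finset V) : ℕ := ∑ y ∈ T, G.defect x y

/-- A clique in which the light edges form a matching. Note that `G.defect x x = 2`. -/
def IsNearFull (T : Finset V) : Prop := ∀ x ∈ T, G.defectTo x T ≤ 3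

/-- The sum of all defects over ordered pairs of elements of `T`. -/
def cost (T : Finset V) : ℕ := ∑ x ∈ T, G.defectTo x T

lemma defect_comm (x y : V) : G.defect x y = G.defect y x := by
  simp [defect, G.symm x y]

@[simp] lemma defect_self (x : V) : G.defect x x = 2 := by
  simp [defect, G.loopless x]

lemma defect_le_two (x y : V) : G.defect x y ≤ 2 := by
  simp [defect]

lemma defectTo_mono (x : V) {S T : Finset V} (h : S ⊆ T) : G.defectTo x S ≤ G.defectTo x T :=
  Finset.sum_le_sum_of_subset h

lemma defect_le_defectTo {x y : V} {T : Finset V} (h : y ∈ T) : G.defect x y ≤ G.defectTo x T :=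
  Finset.single_le_sum (f := fun y => G.defect x y) (fun _ _ => Nat.zero_le _) h

lemma defectTo_eq_zero {x : V} {T : Finset V} :
    G.defectTo x T = 0 ↔ ∀ y ∈ T, G.defect x y = 0 := by
  simp [defectTo]

variable {G}

lemma IsNearFull.subset {S T : Finset V} (hT : G.IsNearFull T) (h : S ⊆ T) : G.IsNearFull S :=
  fun x hx => (G.defectTo_mono x h).trans (hT x (h hx))

variable (G) in
lemma two_le_defectTo {x : V} {T : Finset V} (h : x ∈ T) : 2 ≤ G.defectTo x T := by
  simpa using G.defect_le_defectTo (x := x) h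

lemma exists_of_defectTo_ne_zero {Z : Finset V} {x : V} (h : G.defectTo x Z ≠ 0) :
    ∃ q ∈ Z, G.defect x q ≠ 0 := by
  rw [Ne, defectTo_eq_zero] at h
  push Not at h
  exact h

variable [DecidableEq V]

variable (G) in
lemma defectTo_insert (x : V) {z : V} {T : Finset V} (h : z ∉ T) :
    G.defectTo x (insert z T) = G.defect x z + G.defectTo x T :=
  Finset.sum_insert h

variable (G) in
lemma defectTo_erase (x : V) {z : V} {T : Finset V} (h : z ∈ T) :
    G.defectTo x (T.erase z) + G.defect x z = G.defectTo x T :=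
  Finset.sum_erase_add _ _ h

variable (G) in
lemma defectTo_union (x : V) {S T : Finset V} (h : Disjoint S T) :
    G.defectTo x (S ∪ T) = G.defectTo x S + G.defectTo x T :=
  Finset.sum_union h

variable (G) in
lemma defect_add_le {x y z : V} {T : Finset V} (hy : y ∈ T) (hz : z ∈ T) (hyz : y ≠ z) :
    G.defect x y + G.defect x z ≤ G.defectTo x T := by
  rw [← G.defectTo_erase x hy, add_comm]
  have := G.defect_le_defectTo (x := x) (Finset.mem_erase.2 ⟨hyz.symm, hz⟩)
  omega

lemma IsNearFull.defect_le_one {T : Finset V} (hT : G.IsNearFull T) {x y : V} (hx : x ∈ T)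
    (hy : y ∈ T) (hxy : x ≠ y) : G.defect x y ≤ 1 := by
  have h := G.defect_add_le (x := x) hx hy hxy
  have := hT x hx
  simp at h
  omega

lemma IsNearFull.partner_unique {T : Finset V} (hT : G.IsNearFull T) {x y z : V} (hx : x ∈ T)
    (hy : y ∈ T) (hz : z ∈ T) (hxy : x ≠ y) (hxz : x ≠ z) (h1 : G.defect x y ≠ 0)
    (h2 : G.defect x z ≠ 0) : y = z := by
  by_contra hne
  have h := G.defect_add_le (x := x) (T := T.erase x) (Finset.mem_erase.2 ⟨hxy.symm, hy⟩)
    (Finset.mem_erase.2 ⟨hxz.symm, hz⟩) hne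
  have h3 := G.defectTo_erase x hx
  have := hT x hx
  simp at h3
  omega

variable (G) in
lemma eq_of_defectTo_le_one {T : Finset V} {x y z : V} (hx : G.defectTo x T ≤ 1)
    (hy : y ∈ T) (hz : z ∈ T) (h1 : G.defect x y ≠ 0) (h2 : G.defect x z ≠ 0) : y = z := by
  by_contra hne
  have h := G.defect_add_le (x := x) hy hz hne
  omega

/-- The only possible light edge at `x` ends at a vertex that is still unmatched in `Z`, so the
light edges remain a matching. -/
lemma IsNearFull.insert_of_free {Z : Finset V} (hZ : G.IsNearFull Z) {x : V} (hx : x ∉ Z)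
    (h1 : G.defectTo x Z ≤ 1) (h : ∀ p ∈ Z, G.defect x p ≠ 0 → G.defectTo p Z ≤ 2) :
    G.IsNearFull (insert x Z) := by
  intro y hy
  rw [defectTo_insert _ _ hx]
  rcases Finset.mem_insert.1 hy with rfl | hy
  · simp; omega
  · rw [G.defect_comm]
    by_cases h0 : G.defect x y = 0
    · have := hZ y hy; omega
    · have := h y hy h0
      have := G.defect_le_defectTo (x := x) hy
      omega

lemma IsNearFull.union_of_clean {S T : Finset V} (hS : G.IsNearFull S) (hT : G.IsNearFull T)
    (hd : Disjoint S T) (h : ∀ x ∈ S, ∀ y ∈ T, G.defect x y = 0) : G.IsNearFull (S ∪ T) := by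
  intro x hx
  rw [G.defectTo_union x hd]
  rcases Finset.mem_union.1 hx with hx | hx
  · rw [(G.defectTo_eq_zero).2 (h x hx)]
    simpa using hS x hx
  · rw [(G.defectTo_eq_zero (T := S)).2 (fun y hy => by rw [G.defect_comm]; exact h y hy x hx)]
    simpa using hT x hx

lemma exists_partner {Z : Finset V} {p : V} (hp : p ∈ Z) (h : 3 ≤ G.defectTo p Z) :
    ∃ q ∈ Z, q ≠ p ∧ G.defect p q ≠ 0 := by
  have h1 := G.defectTo_erase p hp
  have h2 : G.defectTo p (Z.erase p) ≠ 0 := by simp at h1; omega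
  rw [Ne, defectTo_eq_zero] at h2
  push Not at h2
  obtain ⟨q, hq, hq'⟩ := h2
  exact ⟨q, Finset.mem_of_mem_erase hq, Finset.ne_of_mem_erase hq, hq'⟩

end Basics

/-! ### Cliques whose light edges lie on admissible paths. -/

section PathClique

variable {V : Type*}

lemma IsPathEdge.symm {P : List V} {x y : V} (h : IsPathEdge P x y) : IsPathEdge P y x := Or.symm h

/-- The admissible sequences of numbers of vertices of the light paths in `𝒦'`, up to paths
with a single vertex. -/
def IsProfile (l : List ℕ) : Prop :=
  ∃ s ∈ ([[], [3], [4], [3, 3]] : List (List ℕ)), ∃ k, l = s ++ List.replicate k 2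

/-- `T` spans a clique whose light edges lie on disjoint paths as in the definition of `𝒦'`. -/
def IsPathClique (G : StdMultigraph V) (T : Finset V) : Prop :=
  ∃ L : List (List V), L.flatten.Nodup ∧ (∀ x ∈ L.flatten, x ∈ T) ∧
    IsProfile (L.map List.length) ∧
    ∀ x ∈ T, ∀ y ∈ T, x ≠ y → G.defect x y ≠ 0 →
      G.defect x y = 1 ∧ ∃ p ∈ L, IsPathEdge p x y

variable {G : StdMultigraph V} [DecidableEq V]

lemma IsNearFull.exists_matching : ∀ {Z : Finset V}, G.IsNearFull Z →
    ∃ L : List (List V), L.flatten.Nodup ∧ (∀ x ∈ L.flatten, x ∈ Z) ∧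
      (∀ p ∈ L, p.length = 2) ∧
      ∀ x ∈ Z, ∀ y ∈ Z, x ≠ y → G.defect x y ≠ 0 → ∃ p ∈ L, IsPathEdge p x y := by
  intro Z
  induction Z using Finset.strongInduction with
  | H Z ih =>
    intro hZ
    by_cases hex : ∃ x ∈ Z, ∃ y ∈ Z, x ≠ y ∧ G.defect x y ≠ 0
    · obtain ⟨x, hx, y, hy, hxy, hd⟩ := hex
      have hsub : (Z.erase x).erase y ⊂ Z :=
        (Finset.erase_subset _ _).trans_ssubset (Finset.erase_ssubset hx)
      obtain ⟨L, hL1, hL2, hL3, hL4⟩ := ih _ hsub (hZ.subset hsub.subset)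
      have hxL : x ∉ L.flatten := fun h => by simpa using hL2 x h
      have hyL : y ∉ L.flatten := fun h => by simpa using hL2 y h
      have hd' : G.defect y x ≠ 0 := by rwa [G.defect_comm]
      refine ⟨[x, y] :: L, ?_, ?_, ?_, ?_⟩
      · simp only [List.flatten_cons, List.cons_append, List.nil_append, List.nodup_cons,
          List.mem_cons]
        exact ⟨by tauto, hyL, hL1⟩
      · intro z hz
        simp only [List.flatten_cons, List.cons_append, List.nil_append, List.mem_cons] at hz
        rcases hz with rfl | rfl | hz
        · exact hx
        · exact hy
        · exact hsub.subset (hL2 z hz)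
      · intro p hp
        rcases List.mem_cons.1 hp with rfl | hp
        · rfl
        · exact hL3 p hp
      · intro a ha b hb hab hdab
        have hdba : G.defect b a ≠ 0 := by rwa [G.defect_comm]
        by_cases h1 : a = x
        · subst h1
          obtain rfl := hZ.partner_unique ha hb hy hab hxy hdab hd
          exact ⟨_, List.mem_cons_self, Or.inl (List.infix_refl _)⟩
        by_cases h2 : a = y
        · subst h2
          obtain rfl := hZ.partner_unique ha hb hx hab hxy.symm hdab hd'
          exact ⟨_, List.mem_cons_self, Or.inr (List.infix_refl _)⟩
        by_cases h3 : b = x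
        · subst h3
          exact absurd (hZ.partner_unique hb ha hy hab.symm hxy hdba hd) h2
        by_cases h4 : b = y
        · subst h4
          exact absurd (hZ.partner_unique hb ha hx hab.symm hxy.symm hdba hd') h1
        obtain ⟨p, hp, hp'⟩ := hL4 a (by simp [*]) b (by simp [*]) hab hdab
        exact ⟨p, List.mem_cons_of_mem _ hp, hp'⟩
    · push Not at hex
      refine ⟨[], by simp, by simp, by simp, fun x hx y hy hxy hd => absurd (hex x hx y hy hxy) hd⟩

/-- The long paths in `Ls` are closed under light adjacency in `T`. What remains is near-full, so
its matching supplies the paths on two vertices. -/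
lemma isPathClique_of_special {T : Finset V} (Ls : List (List V))
    (hprof : Ls.map List.length ∈ ([[], [3], [4], [3, 3]] : List (List ℕ)))
    (hnd : Ls.flatten.Nodup) (hmem : ∀ x ∈ Ls.flatten, x ∈ T)
    (hcov : ∀ x ∈ Ls.flatten, ∀ y ∈ T, x ≠ y → G.defect x y ≠ 0 →
      G.defect x y = 1 ∧ ∃ p ∈ Ls, IsPathEdge p x y)
    (hrest : G.IsNearFull (T \ Ls.flatten.toFinset)) : G.IsPathClique T := by
  obtain ⟨L, hL1, hL2, hL3, hL4⟩ := hrest.exists_matching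
  refine ⟨Ls ++ L, ?_, ?_, ⟨_, hprof, L.length, ?_⟩, ?_⟩
  · rw [List.flatten_append, List.nodup_append]
    refine ⟨hnd, hL1, fun a ha b hb hab => ?_⟩
    subst hab
    simpa [ha] using hL2 a hb
  · intro x hx
    rw [List.flatten_append, List.mem_append] at hx
    rcases hx with hx | hx
    · exact hmem x hx
    · exact (Finset.mem_sdiff.1 (hL2 x hx)).1
  · rw [List.map_append]
    congr 1
    exact List.eq_replicate_iff.2 ⟨by simp, by simpa using hL3⟩
  · intro x hx y hy hxy hd
    by_cases h1 : x ∈ Ls.flatten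
    · obtain ⟨h, p, hp, hp'⟩ := hcov x h1 y hy hxy hd
      exact ⟨h, p, List.mem_append_left _ hp, hp'⟩
    by_cases h2 : y ∈ Ls.flatten
    · rw [G.defect_comm] at hd ⊢
      obtain ⟨h, p, hp, hp'⟩ := hcov y h2 x hx hxy.symm hd
      exact ⟨h, p, List.mem_append_left _ hp, hp'.symm⟩
    have hx' : x ∈ T \ Ls.flatten.toFinset := by simpa using ⟨hx, by simpa using h1⟩
    have hy' : y ∈ T \ Ls.flatten.toFinset := by simpa using ⟨hy, by simpa using h2⟩
    obtain ⟨p, hp, hp'⟩ := hL4 x hx' y hy' hxy hd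
    have := hrest.defect_le_one hx' hy' hxy
    exact ⟨by omega, p, List.mem_append_right _ hp, hp'⟩

lemma IsNearFull.isPathClique {T : Finset V} (hT : G.IsNearFull T) : G.IsPathClique T :=
  isPathClique_of_special [] (by simp) (by simp) (by simp) (by simp) (by simpa using hT)

/-- Adding a vertex of defect at most one to a near-full clique. -/
lemma IsNearFull.isPathClique_insert {Z : Finset V} (hZ : G.IsNearFull Z) {x : V} (hx : x ∉ Z)
    (h1 : G.defectTo x Z ≤ 1) : G.IsPathClique (insert x Z) := by
  by_cases hfree : ∀ p ∈ Z, G.defect x p ≠ 0 → G.defectTo p Z ≤ 2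
  · exact (hZ.insert_of_free hx h1 hfree).isPathClique
  push Not at hfree
  -- Here `p` already has a light partner `q`, and `x`, `p`, `q` become a path on three vertices.
  obtain ⟨p, hp, hxp, hp3⟩ := hfree
  obtain ⟨q, hq, hqp, hpq⟩ := exists_partner hp hp3
  have hxz : ∀ z ∈ Z, G.defect x z ≠ 0 → z = p := fun z hz h =>
    G.eq_of_defectTo_le_one h1 hz hp h hxp
  have hxp1 : G.defect x p ≤ 1 := (G.defect_le_defectTo hp).trans h1
  have hpq1 := hZ.defect_le_one hp hq hqp.symm
  have hpz : ∀ z ∈ Z, p ≠ z → G.defect p z ≠ 0 → z = q := fun z hz h h' =>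
    hZ.partner_unique hp hz hq h hqp.symm h' hpq
  have hqz : ∀ z ∈ Z, q ≠ z → G.defect q z ≠ 0 → z = p := fun z hz h h' =>
    hZ.partner_unique hq hz hp h hqp h' (by rwa [G.defect_comm])
  have e1 : IsPathEdge [x, p, q] x p := Or.inl ⟨[], [q], rfl⟩
  have e2 : IsPathEdge [x, p, q] p q := Or.inl ⟨[x], [], rfl⟩
  have hxp' : x ≠ p := fun h => hx (h ▸ hp)
  have hxq' : x ≠ q := fun h => hx (h ▸ hq)
  refine isPathClique_of_special [[x, p, q]] (by simp) ?_ ?_ ?_ ?_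
  · simp [hxp', hxq', hqp.symm]
  · simp [hp, hq]
  · have e1' := e1.symm
    have e2' := e2.symm
    have c1 := G.defect_comm x p
    have c2 := G.defect_comm x q
    have c3 := G.defect_comm p q
    intro a ha b hb hab hd
    simp only [List.flatten_cons, List.flatten_nil, List.append_nil, List.mem_cons,
      List.not_mem_nil, or_false] at ha
    simp only [List.mem_singleton, exists_eq_left]
    rcases Finset.mem_insert.1 hb with rfl | hbz
    · grind
    · rcases ha with rfl | rfl | rfl
      · obtain rfl := hxz b hbz hd
        exact ⟨by omega, e1⟩
      · obtain rfl := hpz b hbz hab hd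
        exact ⟨by omega, e2⟩
      · obtain rfl := hqz b hbz hab hd
        exact ⟨by omega, e2'⟩
  · refine hZ.subset fun z hz => ?_
    simp at hz
    tauto

/-- Adding two vertices to a near-full clique. -/
lemma IsNearFull.isPathClique_insert_insert {Z : Finset V} (hZ : G.IsNearFull Z) {x y : V}
    (hx : x ∉ Z) (hy : y ∉ Z) (hxy : x ≠ y) (h1 : G.defectTo x Z ≤ 1)
    (h2 : G.defectTo y (insert x Z) ≤ 1)
    (h3 : ¬ ∃ p ∈ Z, G.defect x p ≠ 0 ∧ G.defect y p ≠ 0 ∧ 3 ≤ G.defectTo p Z) :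
    G.IsPathClique (insert y (insert x Z)) := by
  have hyx : y ∉ insert x Z := by simp [hxy.symm, hy]
  have h2' := h2
  rw [G.defectTo_insert y hx] at h2'
  by_cases hfree : ∀ p ∈ Z, G.defect x p ≠ 0 → G.defectTo p Z ≤ 2
  · exact (hZ.insert_of_free hx h1 hfree).isPathClique_insert hyx h2
  push Not at hfree
  obtain ⟨p, hp, hxp, hp3⟩ := hfree
  obtain ⟨q, hq, hqp, hpq⟩ := exists_partner hp hp3
  have hxp1 : G.defect x p ≤ 1 := (G.defect_le_defectTo hp).trans h1
  have hxz : ∀ z ∈ Z, G.defect x z ≠ 0 → z = p := fun z hz h =>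
    G.eq_of_defectTo_le_one h1 hz hp h hxp
  have hpq1 := hZ.defect_le_one hp hq hqp.symm
  have hpz : ∀ z ∈ Z, p ≠ z → G.defect p z ≠ 0 → z = q := fun z hz h h' =>
    hZ.partner_unique hp hz hq h hqp.symm h' hpq
  have hqz : ∀ z ∈ Z, q ≠ z → G.defect q z ≠ 0 → z = p := fun z hz h h' =>
    hZ.partner_unique hq hz hp h hqp h' (by rwa [G.defect_comm])
  have hxp' : x ≠ p := fun h => hx (h ▸ hp)
  have hxq' : x ≠ q := fun h => hx (h ▸ hq)
  have hyp' : y ≠ p := fun h => hy (h ▸ hp)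
  have hyq' : y ≠ q := fun h => hy (h ▸ hq)
  have c1 := G.defect_comm x p
  have c2 := G.defect_comm x q
  have c3 := G.defect_comm p q
  have c4 := G.defect_comm x y
  have c5 := G.defect_comm y p
  have c6 := G.defect_comm y q
  -- If `y` is clean to `Z`, its only possible light edge goes to `x` and produces the path `y`,
  -- `x`, `p`, `q`. Otherwise its light edge ends at some `s` in `Z`.
  by_cases hyZ : G.defectTo y Z = 0
  · have hyz := (G.defectTo_eq_zero).1 hyZ
    by_cases hyx0 : G.defect y x = 0
    · rw [Finset.insert_comm]
      refine (hZ.insert_of_free hy (by omega) (fun z hz h => absurd (hyz z hz) h)).isPathClique_insert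
        (by simp [hxy, hx]) ?_
      rw [G.defectTo_insert x hy]
      omega
    · have e1 : IsPathEdge [y, x, p, q] y x := Or.inl ⟨[], [p, q], rfl⟩
      have e2 : IsPathEdge [y, x, p, q] x p := Or.inl ⟨[y], [q], rfl⟩
      have e3 : IsPathEdge [y, x, p, q] p q := Or.inl ⟨[y, x], [], rfl⟩
      have e1' := e1.symm
      have e2' := e2.symm
      have e3' := e3.symm
      refine isPathClique_of_special [[y, x, p, q]] (by simp) ?_ ?_ ?_ ?_
      · simp [hxp', hxq', hqp.symm, hxy.symm, hyp', hyq']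
      · simp [hp, hq]
      · intro a ha b hb hab hd
        simp only [List.flatten_cons, List.flatten_nil, List.append_nil, List.mem_cons,
          List.not_mem_nil, or_false] at ha
        simp only [List.mem_singleton, exists_eq_left]
        rcases Finset.mem_insert.1 hb with rfl | hbx
        · grind
        rcases Finset.mem_insert.1 hbx with rfl | hbz
        · grind
        · rcases ha with rfl | rfl | rfl | rfl
          · exact absurd (hyz b hbz) hd
          · obtain rfl := hxz b hbz hd
            exact ⟨by omega, e2⟩
          · obtain rfl := hpz b hbz hab hd
            exact ⟨by omega, e3⟩
          · obtain rfl := hqz b hbz hab hd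
            exact ⟨by omega, e3'⟩
      · refine hZ.subset fun z hz => ?_
        simp at hz
        tauto
  obtain ⟨s, hs, hys⟩ := exists_of_defectTo_ne_zero hyZ
  have hys1 := G.defect_le_defectTo (x := y) hs
  have hyx0 : G.defect y x = 0 := by omega
  have hyz : ∀ z ∈ Z, G.defect y z ≠ 0 → z = s := fun z hz h =>
    G.eq_of_defectTo_le_one (by omega) hz hs h hys
  by_cases hs3 : G.defectTo s Z ≤ 2
  · rw [Finset.insert_comm]
    refine (hZ.insert_of_free hy (by omega) (fun z hz h => ?_)).isPathClique_insert
        (by simp [hxy, hx]) ?_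
    · rwa [hyz z hz h]
    · rw [G.defectTo_insert x hy]
      omega
  obtain ⟨t, ht, hts, hst⟩ := exists_partner hs (by omega : 3 ≤ G.defectTo s Z)
  have hsp : s ≠ p := by
    rintro rfl
    exact h3 ⟨s, hs, hxp, hys, by omega⟩
  have hst1 := hZ.defect_le_one hs ht hts.symm
  have hsz : ∀ z ∈ Z, s ≠ z → G.defect s z ≠ 0 → z = t := fun z hz h h' =>
    hZ.partner_unique hs hz ht h hts.symm h' hst
  have htz : ∀ z ∈ Z, t ≠ z → G.defect t z ≠ 0 → z = s := fun z hz h h' =>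
    hZ.partner_unique ht hz hs h hts h' (by rwa [G.defect_comm])
  have hxs' : x ≠ s := fun h => hx (h ▸ hs)
  have hxt' : x ≠ t := fun h => hx (h ▸ ht)
  have hys' : y ≠ s := fun h => hy (h ▸ hs)
  have hyt' : y ≠ t := fun h => hy (h ▸ ht)
  have c7 := G.defect_comm x s
  have c8 := G.defect_comm x t
  have c9 := G.defect_comm y s
  have c10 := G.defect_comm y t
  have c11 := G.defect_comm s t
  -- If `y` attaches to the partner `q` of `p`, one path on four vertices arises, otherwise two
  -- disjoint paths on three. The case `s = p`, a star with three leaves, is what `h3` excludes.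
  by_cases hqs : q = s
  · subst hqs
    have e1 : IsPathEdge [x, p, q, y] x p := Or.inl ⟨[], [q, y], rfl⟩
    have e2 : IsPathEdge [x, p, q, y] p q := Or.inl ⟨[x], [y], rfl⟩
    have e3 : IsPathEdge [x, p, q, y] q y := Or.inl ⟨[x, p], [], rfl⟩
    have e1' := e1.symm
    have e2' := e2.symm
    have e3' := e3.symm
    refine isPathClique_of_special [[x, p, q, y]] (by simp) ?_ ?_ ?_ ?_
    · simp [hxp', hxq', hqp.symm, hxy, hyp'.symm, hyq'.symm]
    · simp [hp, hq]
    · intro a ha b hb hab hd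
      simp only [List.flatten_cons, List.flatten_nil, List.append_nil, List.mem_cons,
        List.not_mem_nil, or_false] at ha
      simp only [List.mem_singleton, exists_eq_left]
      rcases Finset.mem_insert.1 hb with rfl | hbx
      · grind
      rcases Finset.mem_insert.1 hbx with rfl | hbz
      · grind
      · rcases ha with rfl | rfl | rfl | rfl
        · obtain rfl := hxz b hbz hd
          exact ⟨by omega, e1⟩
        · obtain rfl := hpz b hbz hab hd
          exact ⟨by omega, e2⟩
        · obtain rfl := hqz b hbz hab hd
          exact ⟨by omega, e2'⟩
        · obtain rfl := hyz b hbz hd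
          exact ⟨by omega, e3'⟩
    · refine hZ.subset fun z hz => ?_
      simp at hz
      tauto
  · have hqt : q ≠ t := by
      rintro rfl
      exact hsp (hqz s hs (Ne.symm hts.symm) (by rwa [G.defect_comm])) 
    have hpt : p ≠ t := by
      rintro rfl
      exact hqs (hpz s hs hsp.symm (by rwa [G.defect_comm])).symm
    have e1 : IsPathEdge [x, p, q] x p := Or.inl ⟨[], [q], rfl⟩
    have e2 : IsPathEdge [x, p, q] p q := Or.inl ⟨[x], [], rfl⟩
    have e3 : IsPathEdge [y, s, t] y s := Or.inl ⟨[], [t], rfl⟩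
    have e4 : IsPathEdge [y, s, t] s t := Or.inl ⟨[y], [], rfl⟩
    have e1' := e1.symm
    have e2' := e2.symm
    have e3' := e3.symm
    have e4' := e4.symm
    refine isPathClique_of_special [[x, p, q], [y, s, t]] (by simp) ?_ ?_ ?_ ?_
    · simp [hxp', hxq', hqp.symm, hxy, hyp'.symm, hyq'.symm, hxs', hxt', hys', hyt', hsp.symm,
        hpt, hqs, hqt, hts.symm]
    · simp [hp, hq, hs, ht]
    · intro a ha b hb hab hd
      simp only [List.flatten_cons, List.flatten_nil, List.append_nil, List.mem_cons,
        List.not_mem_nil, or_false, List.cons_append, List.nil_append] at ha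
      simp only [List.mem_cons, List.not_mem_nil, or_false, exists_eq_or_imp, exists_eq_left]
      rcases Finset.mem_insert.1 hb with rfl | hbx
      · grind
      rcases Finset.mem_insert.1 hbx with rfl | hbz
      · grind
      · rcases ha with rfl | rfl | rfl | rfl | rfl | rfl
        · obtain rfl := hxz b hbz hd
          exact ⟨by omega, Or.inl e1⟩
        · obtain rfl := hpz b hbz hab hd
          exact ⟨by omega, Or.inl e2⟩
        · obtain rfl := hqz b hbz hab hd
          exact ⟨by omega, Or.inl e2'⟩
        · obtain rfl := hyz b hbz hd
          exact ⟨by omega, Or.inr e3⟩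
        · obtain rfl := hsz b hbz hab hd
          exact ⟨by omega, Or.inr e4⟩
        · obtain rfl := htz b hbz hab hd
          exact ⟨by omega, Or.inr e4'⟩
    · refine hZ.subset fun z hz => ?_
      simp at hz
      tauto

end PathClique

/-! ### From cliques to tiles. -/

section Tile

variable {V : Type*} {G : StdMultigraph V}

lemma IsPathEdge.map {α β : Type*} (f : α → β) {P : List α} {x y : α} (h : IsPathEdge P x y) :
    IsPathEdge (P.map f) (f x) (f y) :=
  h.imp (fun h => h.map f) (fun h => h.map f)

lemma IsProfile.getElem_eq_two {l : List ℕ} (hl : IsProfile l) :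
    (∀ i (h : i < l.length), 2 ≤ l[i]) ∧
    (∀ i j (hi : i < l.length) (hj : j < l.length), i ≤ j → l[j] ≤ l[i]) ∧
    ((∀ i (h : i < l.length), l[i] ≤ if i = 0 then 4 else 2) ∨
      (∀ i (h : i < l.length), l[i] ≤ if i < 2 then 3 else 2)) := by
  obtain ⟨s, hs, k, rfl⟩ := hl
  simp only [List.mem_cons, List.not_mem_nil, or_false] at hs
  rcases hs with rfl | rfl | rfl | rfl
  · simp
    left
    intro i _
    split_ifs <;> omega
  · refine ⟨?_, ?_, Or.inl ?_⟩
    · rintro (_ | i) h <;> simp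
    · rintro (_ | i) (_ | j) hi hj hij <;> simp at *
    · rintro (_ | i) h <;> simp
  · refine ⟨?_, ?_, Or.inl ?_⟩
    · rintro (_ | i) h <;> simp
    · rintro (_ | i) (_ | j) hi hj hij <;> simp at *
    · rintro (_ | i) h <;> simp
  · refine ⟨?_, ?_, Or.inr ?_⟩
    · rintro (_ | _ | i) h <;> simp
    · rintro (_ | _ | i) (_ | _ | j) hi hj hij <;> simp at *
    · rintro (_ | _ | i) h <;> simp

lemma IsPathClique.exists_tile {T : Finset V} (hT : G.IsPathClique T) {k : ℕ} (hk : T.card = k)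
    (hk0 : 0 < k) {X : Set Finitary} (hX : KPrime k ⊆ X) :
    ∃ τ : Tile X G, τ.verts = (T : Set V) := by
  classical
  obtain ⟨L, hnd, hmem, hprof, hcov⟩ := hT
  let e : T ≃ Fin k := T.equivFinOfCardEq hk
  let emb : Fin k ↪ V := e.symm.toEmbedding.trans (Function.Embedding.subtype _)
  let inv : V → Fin k := fun v => if h : v ∈ T then e ⟨v, h⟩ else ⟨0, hk0⟩
  have hinv : ∀ i, inv (emb i) = i := by
    intro i
    simp [inv, emb]
  have hemb : ∀ i, emb i ∈ T := fun i => (e.symm i).2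
  have hemb_inv : ∀ v ∈ T, emb (inv v) = v := by
    intro v hv
    simp [inv, emb, hv]
  have hinj : ∀ v ∈ T, ∀ w ∈ T, inv v = inv w → v = w := by
    intro v hv w hw h
    rw [← hemb_inv v hv, h, hemb_inv w hw]
  have hLmem : ∀ p ∈ L, ∀ x ∈ p, x ∈ T := fun p hp x hx =>
    hmem x (List.mem_flatten.2 ⟨p, hp, hx⟩)
  obtain ⟨hlen, hanti, hbd⟩ := hprof.getElem_eq_two
  simp only [List.length_map, List.getElem_map] at hlen hanti hbd
  rw [List.nodup_flatten] at hnd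
  let P : Fin L.length → List (Fin k) := fun i => (L[i]).map inv
  have hP : (⟨k, completeMinusPaths P⟩ : Finitary) ∈ KPrime k := by
    refine ⟨L.length, P, ?_, ?_, ?_, ?_, ?_, rfl⟩
    · intro i h
      have := hlen i i.2
      have h' : L[i] = [] := by simpa [P] using h
      simp at h'
      simp [h'] at this
    · intro i
      refine List.Nodup.map_on (fun x hx y hy h => ?_) (hnd.1 _ (List.getElem_mem i.2))
      exact hinj x (hLmem _ (List.getElem_mem i.2) x hx) y
        (hLmem _ (List.getElem_mem i.2) y hy) h
    · have key : ∀ i j : Fin L.length, i < j → (P i).Disjoint (P j) := by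
        intro i j hij z hzi hzj
        obtain ⟨x, hx, rfl⟩ := List.mem_map.1 hzi
        obtain ⟨y, hy, hxy⟩ := List.mem_map.1 hzj
        have := hinj y (hLmem _ (List.getElem_mem j.2) y hy) x
          (hLmem _ (List.getElem_mem i.2) x hx) hxy
        subst this
        exact List.pairwise_iff_getElem.1 hnd.2 i j i.2 j.2 hij hx hy
      intro i j hij
      rcases lt_or_gt_of_ne hij with h | h
      · exact key i j h
      · exact (key j i h).symm
    · intro i j hij
      simpa [P] using hanti i j i.2 j.2 hij
    · refine hbd.imp (fun h i => ?_) (fun h i => ?_)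
      · simpa [P] using h i i.2
      · simpa [P] using h i i.2
  refine ⟨⟨⟨k, completeMinusPaths P⟩, hX hP, emb, ?_⟩, ?_⟩
  · intro x y
    simp only [completeMinusPaths]
    split_ifs with h1 h2
    · simp
    · by_cases hd : G.defect (emb x) (emb y) = 0
      · simp only [defect] at hd
        omega
      · have := (hcov _ (hemb x) _ (hemb y) (fun h => h1 (emb.injective h)) hd).1
        simp only [defect] at this
        omega
    -- The tile demands a heavy edge off the paths, and every light edge of the clique lies on a
    -- path. An edge on a path may be heavy in `G`, since copies need not be induced.
    · by_cases hd : G.defect (emb x) (emb y) = 0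
      · simp only [defect] at hd
        omega
      · obtain ⟨-, p, hp, hpe⟩ :=
          hcov _ (hemb x) _ (hemb y) (fun h => h1 (emb.injective h)) hd
        obtain ⟨i, hi, rfl⟩ := List.getElem_of_mem hp
        refine absurd ⟨⟨i, hi⟩, ?_⟩ h2
        simpa [P, hinv] using hpe.map inv
  · ext v
    simp only [Tile.verts, Set.mem_range, Finset.mem_coe]
    exact ⟨fun ⟨i, hi⟩ => hi ▸ hemb i, fun hv => ⟨inv v, hemb_inv v hv⟩⟩

/-- A partition of the vertices into suitable cliques gives a perfect tiling. -/
lemma hasPerfectTiling_of_cliques {X : Set Finitary} {r : ℕ} (hr : 0 < r)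
    (hX : KPrime r ⊆ X) (hX' : KPrime (r + 1) ⊆ X) (F : Finset (Finset V))
    (hdisj : (F : Set (Finset V)).PairwiseDisjoint id)
    (hF : ∀ T ∈ F, G.IsPathClique T ∧ (T.card = r ∨ T.card = r + 1))
    (hcov : ∀ v, ∃ T ∈ F, v ∈ T) : G.HasPerfectTiling X := by
  have hex : ∀ T : F, ∃ τ : Tile X G, τ.verts = ((T : Finset V) : Set V) := by
    rintro ⟨T, hT⟩
    obtain ⟨h1, h2 | h2⟩ := hF T hT
    · exact h1.exists_tile h2 hr hX
    · exact h1.exists_tile h2 (Nat.succ_pos _) hX'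
  choose τ hτ using hex
  refine ⟨Set.range τ, ?_, ?_⟩
  · rintro _ ⟨S, rfl⟩ _ ⟨T, rfl⟩ hne
    have : (S : Finset V) ≠ T := fun h => hne (by rw [Subtype.ext h])
    simp only [Function.onFun, hτ]
    exact_mod_cast hdisj S.2 T.2 this
  · intro v
    obtain ⟨T, hT, hv⟩ := hcov v
    exact ⟨τ ⟨T, hT⟩, ⟨_, rfl⟩, by rw [hτ]; exact_mod_cast hv⟩

end Tile

/-! ### Edge counts in induced submultigraphs, and degrees in terms of defects. -/

section Extremal

variable {V : Type*} {G : StdMultigraph V}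

lemma sum_sym2_le {α : Type*} [Fintype α] [DecidableEq α] (f : Sym2 α → ℕ) :
    ∑ p : Sym2 α, f p ≤ ∑ x : α, ∑ y : α, f s(x, y) := by
  rw [← Fintype.sum_prod_type']
  rw [← Finset.sum_fiberwise_of_maps_to (s := Finset.univ) (t := Finset.univ)
    (g := fun z : α × α => s(z.1, z.2)) (fun _ _ => Finset.mem_univ _)]
  refine Finset.sum_le_sum fun p _ => ?_
  induction p with
  | _ x y =>
    exact Finset.single_le_sum (f := fun z : α × α => f s(z.1, z.2)) (fun _ _ => Nat.zero_le _)
      (by simp : (x, y) ∈ _)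

lemma edgeCount_induce_le (S : Finset V) :
    (G.induce S).edgeCount ≤ ∑ x ∈ S, ∑ y ∈ S, G.mu x y := by
  classical
  refine (sum_sym2_le _).trans (le_of_eq ?_)
  rw [← Finset.sum_coe_sort S]
  refine Finset.sum_congr rfl fun x _ => ?_
  rw [← Finset.sum_coe_sort S]
  rfl

lemma heavyCount_induce_le (S : Finset V) :
    (G.induce S).heavyCount ≤ ∑ x ∈ S, ∑ y ∈ S, if G.mu x y = 2 then 1 else 0 := by
  classical
  rw [heavyCount, Finset.card_filter]
  refine (le_of_eq ?_).trans ((sum_sym2_le (fun p => if (G.induce S).muSym p = 2 then 1 else 0)).trans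
    (le_of_eq ?_))
  · refine Finset.sum_congr (by congr) fun p _ => by congr
  rw [← Finset.sum_coe_sort S]
  refine Finset.sum_congr rfl fun x _ => ?_
  rw [← Finset.sum_coe_sort S]
  rfl

variable [Fintype V]

/-- The self-defect 2 makes this an identity with `2n` in place of `2(n - 1)`. -/
lemma defectTo_univ_add_degree (x : V) :
    G.defectTo x Finset.univ + G.degree x = 2 * Fintype.card V := by
  rw [defectTo, degree, ← Finset.sum_add_distrib]
  rw [Finset.sum_congr rfl (fun y _ => show G.defect x y + G.mu x y = 2 by
    have := G.le_two x y; simp only [defect]; omega)]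
  simp [mul_comm]

lemma minDegree_le_degree (x : V) : G.minDegree ≤ G.degree x :=
  ciInf_le (OrderBot.bddBelow _) x

end Extremal

/-! ### Exchanging vertices between near-full cliques. -/

section Exchange

variable {V : Type*} {G : StdMultigraph V}

lemma sum_defectTo_comm (S T : Finset V) :
    ∑ x ∈ S, G.defectTo x T = ∑ y ∈ T, G.defectTo y S := by
  simp only [defectTo]
  rw [Finset.sum_comm]
  exact Finset.sum_congr rfl fun y _ => Finset.sum_congr rfl fun x _ => G.defect_comm x y

variable [DecidableEq V]

lemma cost_insert {v : V} {Z : Finset V} (hv : v ∉ Z) :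
    G.cost (insert v Z) = G.cost Z + 2 * G.defectTo v Z + 2 := by
  rw [cost, Finset.sum_insert hv, G.defectTo_insert v hv, defect_self,
    Finset.sum_congr rfl fun x _ => G.defectTo_insert x hv, Finset.sum_add_distrib,
    Finset.sum_congr rfl fun x _ => G.defect_comm x v]
  change 2 + G.defectTo v Z + (G.defectTo v Z + G.cost Z) = _
  omega

/-- If `v` cannot simply be added, its one light edge goes to a matched vertex `p`. Then `v` is
clean to the rest of `A`, and replacing `p` by `v` destroys the light edge at `p`. -/
lemma IsNearFull.exists_improved {A : Finset V} (hA : G.IsNearFull A) {v : V} (hv : v ∉ A)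
    (h : G.defectTo v A ≤ 1) : ∃ A' ⊆ insert v A, v ∈ A' ∧ G.IsNearFull A' ∧
      (A'.card = A.card + 1 ∨ A'.card = A.card ∧ G.cost A' < G.cost A) := by
  by_cases hfree : ∀ p ∈ A, G.defect v p ≠ 0 → G.defectTo p A ≤ 2
  · exact ⟨_, subset_rfl, Finset.mem_insert_self _ _, hA.insert_of_free hv h hfree,
      Or.inl (Finset.card_insert_of_notMem hv)⟩
  push Not at hfree
  obtain ⟨p, hp, hvp, hp3⟩ := hfree
  have hvZ : v ∉ A.erase p := fun h => hv (Finset.mem_of_mem_erase h)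
  have h0 := G.defectTo_erase v hp
  have h1 := G.defectTo_erase p hp
  have hd0 : G.defectTo v (A.erase p) = 0 := by omega
  refine ⟨insert v (A.erase p), Finset.insert_subset_insert _ (Finset.erase_subset _ _),
    Finset.mem_insert_self _ _, ?_, Or.inr ⟨?_, ?_⟩⟩
  · exact (hA.subset (Finset.erase_subset _ _)).insert_of_free hvZ (by omega)
      (fun q hq hq' => absurd ((G.defectTo_eq_zero).1 hd0 q hq) hq')
  · rw [Finset.card_insert_of_notMem hvZ, Finset.card_erase_add_one hp]
  · rw [cost_insert hvZ]
    have h2 := cost_insert (G := G) (Finset.notMem_erase p A)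
    rw [Finset.insert_erase hp] at h2
    simp at h1
    omega

/-- If the defect between two near-full cliques `A` and `B` is small, then some vertex `b` of `B`
can be released by replacing part of `B` with part of `A`. -/
lemma IsNearFull.exists_exchange {A B : Finset V} (hA : G.IsNearFull A) (hB : G.IsNearFull B)
    (hAB : Disjoint A B) (hcard : A.card ≤ B.card)
    (hsum : ∑ x ∈ A, G.defectTo x B < 2 * A.card) :
    ∃ b ∈ B, G.defectTo b A ≤ 1 ∧
      ∃ T ⊆ A ∪ B, b ∉ T ∧ G.IsNearFull T ∧ T.card = B.card := by
  let N : Finset V → Finset V := fun R => B.filter fun b => ∃ x ∈ R, G.defect x b ≠ 0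
  -- Since `S` contains all vertices of `B` with positive defect to `R`, replacing `S` by `R` keeps
  -- `B` near-full and releases every vertex of `S`.
  have build : ∀ R ⊆ A, ∀ S ⊆ B, N R ⊆ S → S.card = R.card → ∀ b ∈ S, G.defectTo b A ≤ 1 →
      ∃ b ∈ B, G.defectTo b A ≤ 1 ∧ ∃ T ⊆ A ∪ B, b ∉ T ∧ G.IsNearFull T ∧ T.card = B.card := by
    intro R hR S hS hNS hSR b hb hbA
    have hdisj : Disjoint R (B \ S) := (hAB.mono hR Finset.sdiff_subset)
    refine ⟨b, hS hb, hbA, R ∪ B \ S, ?_, ?_, ?_, ?_⟩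
    · exact Finset.union_subset_union hR Finset.sdiff_subset
    · have := Finset.disjoint_right.1 hAB (hS hb)
      simp only [Finset.mem_union, Finset.mem_sdiff, not_or, not_and, not_not]
      exact ⟨fun h => this (hR h), fun _ => hb⟩
    · refine (hA.subset hR).union_of_clean (hB.subset Finset.sdiff_subset) hdisj ?_
      intro x hx y hy
      by_contra hne
      have hy' := Finset.mem_sdiff.1 hy
      exact hy'.2 (hNS (Finset.mem_filter.2 ⟨hy'.1, x, hx, hne⟩))
    · rw [Finset.card_union_of_disjoint hdisj, Finset.card_sdiff_of_subset hS, hSR]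
      have := Finset.card_le_card hS
      omega
  -- A Hall-type choice: the factor `A.card + 1` makes the surplus `|R| - |N R|` the first criterion
  -- and `|R|` the second. Comparison with `∅` shows that the surplus is not negative.
  obtain ⟨R, hRmem, hRmax⟩ := Finset.exists_max_image A.powerset
    (fun R => ((A.card + 1 : ℤ) * (R.card - (N R).card) + R.card)) ⟨∅, by simp⟩
  have hR : R ⊆ A := Finset.mem_powerset.1 hRmem
  have hN0 : N ∅ = ∅ := by simp [N]
  have hge : (N R).card ≤ R.card := by
    have h0 := hRmax ∅ (by simp)
    have hRA : (R.card : ℤ) ≤ A.card := by exact_mod_cast Finset.card_le_card hR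
    simp only [hN0, Finset.card_empty] at h0
    by_contra hlt
    push Not at hlt
    have : ((R.card : ℤ) - (N R).card) ≤ -1 := by omega
    nlinarith
  have hcol : ∑ b ∈ B, G.defectTo b A < 2 * A.card := by rwa [← sum_defectTo_comm]
  rcases hge.lt_or_eq with hlt | heq
  -- With positive surplus there is room in `S` for an arbitrary `b`. A suitable one exists by
  -- averaging, as the total defect is below `2 * A.card ≤ 2 * B.card`.
  · obtain ⟨b, hb, hbA⟩ : ∃ b ∈ B, G.defectTo b A ≤ 1 := by
      by_contra! hcon
      have h2 : ∑ b ∈ B, 2 ≤ ∑ b ∈ B, G.defectTo b A := Finset.sum_le_sum hcon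
      simp at h2
      omega
    have hsub : insert b (N R) ⊆ B := Finset.insert_subset hb (Finset.filter_subset _ _)
    have hc : (insert b (N R)).card ≤ R.card := (Finset.card_insert_le _ _).trans hlt
    obtain ⟨S, hS1, hS2, hS3⟩ := Finset.exists_subsuperset_card_eq hsub hc
      ((Finset.card_le_card hR).trans hcard)
    exact build R hR S hS2 ((Finset.subset_insert _ _).trans hS1) hS3 b
      (hS1 (Finset.mem_insert_self _ _)) hbA
  · by_cases hgood : ∃ b ∈ N R, G.defectTo b A ≤ 1
    · obtain ⟨b, hb, hbA⟩ := hgood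
      exact build R hR (N R) (Finset.filter_subset _ _) subset_rfl heq b hb hbA
    push Not at hgood
    exfalso
    -- An `x` violating this would bring in at most one new neighbour, so adding it to `R` would
    -- keep the surplus and increase the size. Together with `hgood` this gives total defect at
    -- least `2 * |N R| + 2 * |A \ R| = 2 * |A|`, a contradiction.
    have hrow : ∀ x ∈ A \ R, 2 ≤ G.defectTo x (B \ N R) := by
      intro x hx
      obtain ⟨hxA, hxR⟩ := Finset.mem_sdiff.1 hx
      by_contra! hlt
      have h0 := hRmax (insert x R) (Finset.mem_powerset.2 (Finset.insert_subset hxA hR))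
      have hNi : N (insert x R) ⊆ N R ∪ (B \ N R).filter fun b => G.defect x b ≠ 0 := by
        intro b hb
        obtain ⟨hbB, y, hy, hyb⟩ := Finset.mem_filter.1 hb
        by_cases hbN : b ∈ N R
        · exact Finset.mem_union_left _ hbN
        · refine Finset.mem_union_right _ (Finset.mem_filter.2 ⟨Finset.mem_sdiff.2 ⟨hbB, hbN⟩, ?_⟩)
          rcases Finset.mem_insert.1 hy with rfl | hy
          · exact hyb
          · exact absurd (Finset.mem_filter.2 ⟨hbB, y, hy, hyb⟩) hbN
      have hc1 : ((B \ N R).filter fun b => G.defect x b ≠ 0).card ≤ G.defectTo x (B \ N R) := by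
        rw [Finset.card_filter]
        refine Finset.sum_le_sum fun b _ => ?_
        split_ifs <;> omega
      have hc2 := (Finset.card_le_card hNi).trans (Finset.card_union_le _ _)
      rw [Finset.card_insert_of_notMem hxR] at h0
      have hc3 : ((N (insert x R)).card : ℤ) ≤ R.card + 1 := by omega
      have hc4 : (0 : ℤ) ≤ A.card := by positivity
      have hc5 : ((N R).card : ℤ) = R.card := by exact_mod_cast heq
      push_cast at h0
      rw [hc5] at h0
      nlinarith
    have hNsum : 2 * (N R).card ≤ ∑ x ∈ A, G.defectTo x (N R) := by
      rw [sum_defectTo_comm]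
      have h2 : ∑ b ∈ N R, 2 ≤ ∑ b ∈ N R, G.defectTo b A := Finset.sum_le_sum hgood
      simp at h2
      omega
    have hrsum : 2 * (A \ R).card ≤ ∑ x ∈ A, G.defectTo x (B \ N R) := by
      have h2 : ∑ b ∈ A \ R, 2 ≤ ∑ x ∈ A \ R, G.defectTo x (B \ N R) := Finset.sum_le_sum hrow
      have h3 : ∑ x ∈ A \ R, G.defectTo x (B \ N R) ≤ ∑ x ∈ A, G.defectTo x (B \ N R) :=
        Finset.sum_le_sum_of_subset Finset.sdiff_subset
      simp at h2
      omega
    have htot : ∑ x ∈ A, G.defectTo x B =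
        ∑ x ∈ A, G.defectTo x (N R) + ∑ x ∈ A, G.defectTo x (B \ N R) := by
      rw [← Finset.sum_add_distrib]
      refine Finset.sum_congr rfl fun x _ => ?_
      rw [← G.defectTo_union x Finset.disjoint_sdiff,
        Finset.union_sdiff_of_subset (Finset.filter_subset _ _)]
    rw [Finset.card_sdiff_of_subset hR] at hrsum
    have := Finset.card_le_card hR
    omega

end Exchange

/-! ### Families of cliques of maximal weight. -/

section Family

variable {V : Type*} (G : StdMultigraph V)

/-- The priority of a near-full clique in the choice of an optimal family. -/
def key (r : ℕ) (T : Finset V) : ℕ :=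
  if T.card = r then 4 * (r + 1) * r else 4 * (r + 1) * T.card - G.cost T

/-- A family of disjoint nonempty near-full cliques with at most `r` vertices. -/
structure IsFamily (r : ℕ) (F : Finset (Finset V)) : Prop where
  disj : (F : Set (Finset V)).PairwiseDisjoint id
  nearFull : ∀ T ∈ F, G.IsNearFull T
  nonempty : ∀ T ∈ F, T.Nonempty
  card_le : ∀ T ∈ F, T.card ≤ r

/-- The quantity maximised by an optimal family. -/
def weight (r : ℕ) (F : Finset (Finset V)) : ℕ := ∑ T ∈ F, 4 ^ G.key r T

variable {G}

lemma IsNearFull.cost_le {T : Finset V} (hT : G.IsNearFull T) : G.cost T ≤ 3 * T.card := by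
  rw [mul_comm, ← smul_eq_mul]
  exact Finset.sum_le_card_nsmul _ _ _ hT

lemma two_mul_card_le_cost (T : Finset V) : 2 * T.card ≤ G.cost T := by
  rw [mul_comm, ← smul_eq_mul]
  exact Finset.card_nsmul_le_sum _ _ _ fun _ h => G.two_le_defectTo h

lemma key_le {r : ℕ} {T : Finset V} (hT : T.card ≤ r) : G.key r T ≤ 4 * (r + 1) * r := by
  rw [key]
  split_ifs
  · rfl
  · exact (Nat.sub_le _ _).trans (Nat.mul_le_mul_left _ hT)

/-- The factor `4 * (r + 1)` in `key` exceeds any possible change of cost, which is at most three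
per vertex, so order takes precedence over cost. -/
lemma key_lt_key {r : ℕ} {A A' : Finset V} (hA : A.card < r) (hA0 : A.Nonempty)
    (hNA : G.IsNearFull A)
    (hA' : G.IsNearFull A') (h : A'.card = A.card + 1 ∨ A'.card = A.card ∧ G.cost A' < G.cost A) :
    G.key r A < G.key r A' := by
  have h1 := G.two_mul_card_le_cost A
  have h2 := hA'.cost_le
  have h3 := hNA.cost_le
  have h4 := hA0.card_pos
  rw [key, if_neg hA.ne, key]
  rcases h with h | ⟨h, hc⟩
  · split_ifs with hr
    · have : 4 * (r + 1) * A.card ≤ 4 * (r + 1) * r := Nat.mul_le_mul_left _ hA.le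
      have : A.card ≤ 4 * (r + 1) * A.card := Nat.le_mul_of_pos_left _ (by positivity)
      omega
    · obtain ⟨c, hc⟩ : ∃ c, c = 4 * (r + 1) := ⟨_, rfl⟩
      rw [h, ← hc, mul_add, mul_one]
      omega
  · rw [if_neg (by omega), h]
    have : 3 * A.card ≤ 4 * (r + 1) * A.card := Nat.mul_le_mul_right _ (by omega)
    omega

variable (G) in
/-- An optimal family. -/
structure IsOptimal (r : ℕ) (F : Finset (Finset V)) : Prop extends G.IsFamily r F where
  weight_le : ∀ F', G.IsFamily r F' → G.weight r F' ≤ G.weight r F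

variable (G) in
lemma exists_isOptimal [Fintype V] (r : ℕ) : ∃ F, G.IsOptimal r F := by
  classical
  obtain ⟨F, hF, hmax⟩ := Finset.exists_max_image
    (Finset.univ.filter fun F : Finset (Finset V) => G.IsFamily r F) (G.weight r)
    ⟨∅, by simp only [Finset.mem_filter, Finset.mem_univ, true_and]; constructor <;> simp⟩
  simp only [Finset.mem_filter, Finset.mem_univ, true_and] at hF hmax
  exact ⟨F, hF, hmax⟩

lemma isFamily_singleton {r : ℕ} {T : Finset V} (h : G.IsNearFull T) (h0 : T.Nonempty)
    (hr : T.card ≤ r) : G.IsFamily r {T} := by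
  constructor <;> simp [h, h0, hr]

variable [DecidableEq V]

lemma IsFamily.exchange {r : ℕ} {F R N : Finset (Finset V)} (hF : G.IsFamily r F)
    (hN : G.IsFamily r N) (hRN : ∀ S ∈ F \ R, ∀ T ∈ N, Disjoint S T) :
    G.IsFamily r (F \ R ∪ N) ∧ Disjoint (F \ R) N := by
  have hd : Disjoint (F \ R) N := by
    rw [Finset.disjoint_left]
    intro S hS hS'
    have := hRN S hS S hS'
    rw [disjoint_self] at this
    exact (hN.nonempty S hS').ne_empty this
  refine ⟨⟨?_, ?_, ?_, ?_⟩, hd⟩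
  · intro S hS T hT hST
    simp only [Finset.coe_union, Set.mem_union, Finset.mem_coe] at hS hT
    rcases hS with hS | hS <;> rcases hT with hT | hT
    · exact hF.disj (Finset.mem_sdiff.1 hS).1 (Finset.mem_sdiff.1 hT).1 hST
    · exact hRN S hS T hT
    · exact (hRN T hT S hS).symm
    · exact hN.disj hS hT hST
  · intro T hT
    rcases Finset.mem_union.1 hT with hT | hT
    exacts [hF.nearFull T (Finset.mem_sdiff.1 hT).1, hN.nearFull T hT]
  · intro T hT
    rcases Finset.mem_union.1 hT with hT | hT
    exacts [hF.nonempty T (Finset.mem_sdiff.1 hT).1, hN.nonempty T hT]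
  · intro T hT
    rcases Finset.mem_union.1 hT with hT | hT
    exacts [hF.card_le T (Finset.mem_sdiff.1 hT).1, hN.card_le T hT]

/-- Optimality in local form. Vertices may become uncovered in an exchange, because families are not
required to cover. -/
lemma IsOptimal.weight_le_of_exchange {r : ℕ} {F R N : Finset (Finset V)} (hF : G.IsOptimal r F)
    (hR : R ⊆ F) (hN : G.IsFamily r N) (hRN : ∀ S ∈ F \ R, ∀ T ∈ N, Disjoint S T) :
    G.weight r N ≤ G.weight r R := by
  obtain ⟨h1, h2⟩ := hF.toIsFamily.exchange hN hRN
  have h3 := hF.weight_le _ h1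
  rw [weight, Finset.sum_union h2, weight, ← Finset.sum_sdiff hR] at h3
  exact Nat.le_of_add_le_add_left h3

lemma IsFamily.disjoint_of_subset {r : ℕ} {F R : Finset (Finset V)} (hF : G.IsFamily r F)
    (hR : R ⊆ F) {S T : Finset V} (hS : S ∈ F \ R) (hT : ∀ x ∈ T, ∃ A ∈ R, x ∈ A) :
    Disjoint S T := by
  rw [Finset.disjoint_left]
  intro x hxS hxT
  obtain ⟨A, hA, hxA⟩ := hT x hxT
  obtain ⟨h1, h2⟩ := Finset.mem_sdiff.1 hS
  have : S ≠ A := fun h => h2 (h ▸ hA)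
  exact Finset.disjoint_left.1 (hF.disj h1 (hR hA) this) hxS hxA

lemma isFamily_pair {r : ℕ} {S T : Finset V} (hS : G.IsNearFull S) (hS0 : S.Nonempty)
    (hSr : S.card ≤ r) (hT : G.IsNearFull T) (hT0 : T.Nonempty)
    (hTr : T.card ≤ r) (hST : Disjoint S T) : G.IsFamily r {S, T} := by
  constructor
  · rw [Finset.coe_pair]
    exact Set.pairwise_pair.2 fun _ => ⟨hST, hST.symm⟩
  all_goals simp [*]

lemma IsOptimal.exists_mem {r : ℕ} (hr : 0 < r) {F : Finset (Finset V)} (hF : G.IsOptimal r F)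
    (v : V) : ∃ T ∈ F, v ∈ T := by
  by_contra! hv
  have h1 : G.IsFamily r {({v} : Finset V)} := by
    refine isFamily_singleton ?_ (by simp) (by simpa [Nat.one_le_iff_ne_zero] using hr.ne')
    intro x hx
    rw [Finset.mem_singleton.1 hx]
    simp [defectTo]
  have := hF.weight_le_of_exchange (Finset.empty_subset _) h1 (by
    intro S hS T hT
    rw [Finset.mem_singleton.1 hT, Finset.disjoint_singleton_right]
    exact hv S (Finset.mem_sdiff.1 hS).1)
  simp [weight] at this

/-- Otherwise `v` improves `A`, and all of `X` can be discarded: a key gain of one multiplies the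
weight by 4, which beats the two terms lost. -/
lemma IsOptimal.two_le_defectTo_of_key_le {r : ℕ} {F : Finset (Finset V)} (hF : G.IsOptimal r F)
    {A X : Finset V} (hA : A ∈ F) (hX : X ∈ F) (hAr : A.card < r) (hk : G.key r X ≤ G.key r A)
    {v : V} (hv : v ∈ X) : 2 ≤ G.defectTo v A := by
  by_cases hAX : A = X
  · subst hAX
    exact G.two_le_defectTo hv
  by_contra! hlt
  have hvA : v ∉ A := fun h => Finset.disjoint_left.1 (hF.disj hA hX hAX) h hv
  obtain ⟨A', hsub, hvA', hnf, hbetter⟩ :=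
    (hF.nearFull A hA).exists_improved hvA (by omega)
  have hkey := key_lt_key hAr (hF.nonempty A hA) (hF.nearFull A hA) hnf hbetter
  have hR : ({A, X} : Finset (Finset V)) ⊆ F := by
    intro S hS
    rcases Finset.mem_insert.1 hS with rfl | hS
    · exact hA
    · rwa [Finset.mem_singleton.1 hS]
  have := hF.weight_le_of_exchange hR
    (isFamily_singleton hnf ⟨v, hvA'⟩ (by omega)) (by
      intro S hS T hT
      rw [Finset.mem_singleton.1 hT]
      refine hF.disjoint_of_subset hR hS fun x hx => ?_
      rcases Finset.mem_insert.1 (hsub hx) with rfl | hx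
      · exact ⟨X, by simp, hv⟩
      · exact ⟨A, by simp, hx⟩)
  simp only [weight, Finset.sum_singleton, Finset.sum_pair hAX] at this
  have h1 : 4 ^ (G.key r A + 1) ≤ 4 ^ G.key r A' := Nat.pow_le_pow_right (by norm_num) hkey
  have h2 : 4 ^ G.key r X ≤ 4 ^ G.key r A := Nat.pow_le_pow_right (by norm_num) hk
  have h3 : 0 < 4 ^ G.key r A := by positivity
  rw [pow_succ] at h1
  omega

/-- Each such `A` lets `B` release a vertex `b` of defect at most 1 to `A`. With more than `r` of
them, two release the same `b`: rebuild a full clique from `A₁ ∪ B` without `b`, and use `b` to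
improve `A₂`. -/
lemma IsOptimal.card_small_defect_le {r : ℕ} {F : Finset (Finset V)} (hF : G.IsOptimal r F)
    {B : Finset V} (hB : B ∈ F) (hBr : B.card = r) (k : ℕ) :
    (F.filter fun A => A.card < r ∧ G.key r A = k ∧
      ∑ x ∈ A, G.defectTo x B < 2 * A.card).card ≤ r := by
  set 𝒜 := F.filter fun A => A.card < r ∧ G.key r A = k ∧
      ∑ x ∈ A, G.defectTo x B < 2 * A.card with h𝒜
  have hmem : ∀ A ∈ 𝒜, A ∈ F ∧ A.card < r ∧ G.key r A = k ∧
      ∑ x ∈ A, G.defectTo x B < 2 * A.card := fun A hA => by simpa [h𝒜] using hA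
  have hdisj : ∀ A ∈ 𝒜, Disjoint A B := by
    intro A hA
    refine hF.disj (hmem A hA).1 hB ?_
    rintro rfl
    exact (hmem A hA).2.1.ne hBr
  have hex : ∀ A ∈ 𝒜, ∃ b ∈ B, G.defectTo b A ≤ 1 ∧
      ∃ T ⊆ A ∪ B, b ∉ T ∧ G.IsNearFull T ∧ T.card = B.card := fun A hA =>
    (hF.nearFull A (hmem A hA).1).exists_exchange (hF.nearFull B hB) (hdisj A hA)
      (by have := (hmem A hA).2.1; omega) (hmem A hA).2.2.2
  by_contra! hlt
  have : Nonempty V := by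
    obtain ⟨A, hA⟩ := Finset.card_pos.1 (Nat.zero_lt_of_lt hlt)
    exact ⟨(hex A hA).choose⟩
  choose! f hf using hex
  obtain ⟨A₁, hA₁, A₂, hA₂, hne, heq⟩ :=
    Finset.exists_ne_map_eq_of_card_lt_of_maps_to (hBr ▸ hlt) (fun A hA => (hf A hA).1)
  obtain ⟨hb, -, T, hTsub, hbT, hTnf, hTcard⟩ := hf A₁ hA₁
  have hb2 := (hf A₂ hA₂).2.1
  rw [← heq] at hb2
  set b := f A₁
  obtain ⟨hF1, hr1, hk1, -⟩ := hmem A₁ hA₁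
  obtain ⟨hF2, hr2, hk2, -⟩ := hmem A₂ hA₂
  have hbA₂ : b ∉ A₂ := Finset.disjoint_right.1 (hdisj A₂ hA₂) hb
  obtain ⟨A', hsub, hbA', hnf, hbetter⟩ := (hF.nearFull A₂ hF2).exists_improved hbA₂ hb2
  have hkey := key_lt_key hr2 (hF.nonempty A₂ hF2) (hF.nearFull A₂ hF2) hnf hbetter
  have hR : ({B, A₁, A₂} : Finset (Finset V)) ⊆ F := by
    intro S hS
    simp only [Finset.mem_insert, Finset.mem_singleton] at hS
    rcases hS with rfl | rfl | rfl <;> assumption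
  have hBA₁ : B ≠ A₁ := by rintro rfl; omega
  have hBA₂ : B ≠ A₂ := by rintro rfl; omega
  have hTA' : Disjoint T A' := by
    rw [Finset.disjoint_left]
    intro x hxT hxA
    rcases Finset.mem_insert.1 (hsub hxA) with rfl | hx
    · exact hbT hxT
    · rcases Finset.mem_union.1 (hTsub hxT) with h | h
      · exact Finset.disjoint_left.1 (hF.disj hF1 hF2 hne) h hx
      · exact Finset.disjoint_left.1 (hF.disj hB hF2 hBA₂) h hx
  have hT0 : T.Nonempty := by rw [← Finset.card_pos]; omega
  have := hF.weight_le_of_exchange hR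
    (isFamily_pair hTnf hT0 (by omega) hnf ⟨b, hbA'⟩ (by omega) hTA') (by
      intro S hS W hW
      refine hF.disjoint_of_subset hR hS fun x hx => ?_
      rcases Finset.mem_insert.1 hW with rfl | hW
      · rcases Finset.mem_union.1 (hTsub hx) with h | h
        · exact ⟨A₁, by simp, h⟩
        · exact ⟨B, by simp, h⟩
      · rw [Finset.mem_singleton.1 hW] at hx
        rcases Finset.mem_insert.1 (hsub hx) with rfl | hx
        · exact ⟨B, by simp, hb⟩
        · exact ⟨A₂, by simp, hx⟩)
  have hTne : T ≠ A' := by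
    rintro rfl
    exact hbT hbA'
  rw [weight, weight, Finset.sum_pair hTne, Finset.sum_insert (by simp [hBA₁, hBA₂]),
    Finset.sum_pair hne] at this
  -- All cliques of order `r` have the same key whatever their cost, so the rebuilt clique loses
  -- nothing.
  have hkT : G.key r T = G.key r B := by
    rw [key, key, if_pos (hTcard.trans hBr), if_pos hBr]
  rw [hkT] at this
  have h1 : 4 ^ (G.key r A₂ + 1) ≤ 4 ^ G.key r A' := Nat.pow_le_pow_right (by norm_num) hkey
  have h3 : 0 < 4 ^ G.key r A₂ := by positivity
  rw [pow_succ] at h1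
  rw [hk1, ← hk2] at this
  omega

end Family

/-! ### Few vertices lie outside the full cliques. -/

section Leftover

variable {V : Type*} {G : StdMultigraph V} [DecidableEq V] [Fintype V]

lemma sum_over_partition {F : Finset (Finset V)} (hF : (F : Set (Finset V)).PairwiseDisjoint id)
    (hcov : ∀ v, ∃ T ∈ F, v ∈ T) (f : V → ℕ) : ∑ T ∈ F, ∑ v ∈ T, f v = ∑ v, f v := by
  have h := Finset.sum_biUnion (f := f) hF
  simp only [id] at h
  rw [← h]
  refine Finset.sum_congr ?_ fun _ _ => rfl
  ext v
  simpa using hcov v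

/-- After multiplication by `r` and substitution of `r * N = n - L - M`, the coefficient of `L` is
`r * m - s`. It is at least `m` because the cliques counted by `m` have at most `r - 1` vertices. -/
lemma step_arith {r η n M m s L N : ℝ} (hr : 0 < r) (hη : 0 ≤ η) (hM : 0 ≤ M) (hL : 0 ≤ L)
    (hm0 : 0 ≤ m) (hN : 0 ≤ N) (hsm : s ≤ m * (r - 1)) (hn : n = r * N + (L + M))
    (h : 2 * m * L + N * (2 * s) ≤ s * (2 * (1 / r + η) * n) + N * (2 * r ^ 2)) :
    m * L ≤ m * (r * M + r ^ 2 * η * n) + r ^ 2 * n := by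
  have hn0 : 0 ≤ n := by rw [hn]; positivity
  have h2 : r * (s * (2 * (1 / r + η) * n)) = 2 * s * n + 2 * r * s * η * n := by
    field_simp
  have h3 := mul_le_mul_of_nonneg_left h hr.le
  rw [mul_add r (s * _) _, h2] at h3
  have h4 : 2 * s * n = 2 * s * (r * N) + 2 * s * L + 2 * s * M := by rw [hn]; ring
  have h5 : r * m * L - s * L ≤ s * M + r * s * η * n + r ^ 2 * (r * N) := by linarith
  have h6 : s * L ≤ m * (r - 1) * L := mul_le_mul_of_nonneg_right hsm hL
  have h7 : s ≤ m * r := by linarith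
  have h8 : s * M ≤ m * r * M := mul_le_mul_of_nonneg_right h7 hM
  have h9 : s * (r * η * n) ≤ m * r * (r * η * n) :=
    mul_le_mul_of_nonneg_right h7 (by positivity)
  have h10 : r ^ 2 * (r * N) ≤ r ^ 2 * n :=
    mul_le_mul_of_nonneg_left (by linarith) (by positivity)
  linarith

/-- Count the defect leaving the non-full cliques of key `k`. It is at least `2 * X.card` per clique
to each non-full `X` of key at most `k`, and to each full clique at least twice their total order up
to an error `2 * r ^ 2`. The degree condition bounds the total from above. -/
lemma IsOptimal.leftover_step {r : ℕ} (hr : 0 < r) {F : Finset (Finset V)}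
    (hF : G.IsOptimal r F) {η : ℝ}
    (hdeg : ∀ x, (G.defectTo x Finset.univ : ℝ) ≤ 2 * (1 / r + η) * Fintype.card V)
    (hη : 0 ≤ η) (k : ℕ) :
    ((F.filter fun A => A.card < r ∧ G.key r A = k).card : ℝ) *
        (∑ T ∈ F.filter (fun A => A.card < r ∧ G.key r A ≤ k), T.card : ℕ) ≤
      (F.filter fun A => A.card < r ∧ G.key r A = k).card *
        (r * (∑ T ∈ F.filter (fun A => A.card < r ∧ k < G.key r A), T.card : ℕ) +
          r ^ 2 * η * Fintype.card V) + r ^ 2 * Fintype.card V := by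
  set 𝒜 := F.filter fun A => A.card < r ∧ G.key r A = k with h𝒜
  set Fle := F.filter fun A => A.card < r ∧ G.key r A ≤ k with hFle
  set Fgt := F.filter fun A => A.card < r ∧ k < G.key r A with hFgt
  set Fr := F.filter fun A => A.card = r with hFr
  set s := ∑ A ∈ 𝒜, A.card with hs
  set n := Fintype.card V with hn
  have hcov := hF.exists_mem hr
  have hsplit : ∀ f : Finset V → ℕ, ∑ T ∈ F, f T =
      ∑ T ∈ Fr, f T + (∑ T ∈ Fle, f T + ∑ T ∈ Fgt, f T) := by
    intro f
    rw [← Finset.sum_filter_add_sum_filter_not F (fun A => A.card = r)]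
    congr 1
    rw [← Finset.sum_filter_add_sum_filter_not (F.filter fun A => ¬ A.card = r)
      (fun A => G.key r A ≤ k), Finset.filter_filter, Finset.filter_filter]
    congr 1
    · refine Finset.sum_congr (Finset.filter_congr fun A hA => ?_) fun _ _ => rfl
      have := hF.card_le A hA
      constructor <;> rintro ⟨h1, h2⟩ <;> exact ⟨by omega, h2⟩
    · refine Finset.sum_congr (Finset.filter_congr fun A hA => ?_) fun _ _ => rfl
      have := hF.card_le A hA
      constructor <;> rintro ⟨h1, h2⟩ <;> exact ⟨by omega, by omega⟩
  have hnsum : n = r * Fr.card + (∑ T ∈ Fle, T.card + ∑ T ∈ Fgt, T.card) := by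
    have h1 := sum_over_partition hF.disj hcov (fun _ => 1)
    simp only [Finset.sum_const, smul_eq_mul, mul_one, Finset.card_univ] at h1
    rw [hn, ← h1, hsplit]
    congr 1
    rw [Finset.sum_congr rfl fun T hT => (Finset.mem_filter.1 hT).2, Finset.sum_const,
      smul_eq_mul, mul_comm]
  have hmemA : ∀ A ∈ 𝒜, A ∈ F ∧ A.card < r ∧ G.key r A = k := fun A hA => by simpa [h𝒜] using hA
  have hle : ∀ X ∈ Fle, 2 * 𝒜.card * X.card ≤ ∑ A ∈ 𝒜, ∑ x ∈ A, G.defectTo x X := by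
    intro X hX
    obtain ⟨hXF, -, hXk⟩ := Finset.mem_filter.1 hX
    have : 𝒜.card • (2 * X.card) ≤ ∑ A ∈ 𝒜, ∑ x ∈ A, G.defectTo x X := by
      refine Finset.card_nsmul_le_sum _ _ _ fun A hA => ?_
      obtain ⟨hAF, hAr, hAk⟩ := hmemA A hA
      rw [sum_defectTo_comm, mul_comm, ← smul_eq_mul]
      exact Finset.card_nsmul_le_sum _ _ _ fun v hv =>
        hF.two_le_defectTo_of_key_le hAF hXF hAr (hAk ▸ hXk) hv
    rw [smul_eq_mul] at this
    calc _ = _ := by ring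
      _ ≤ _ := this
  have hreq : ∀ X ∈ Fr, 2 * s ≤ ∑ A ∈ 𝒜, ∑ x ∈ A, G.defectTo x X + 2 * r ^ 2 := by
    intro X hX
    obtain ⟨hXF, hXr⟩ := Finset.mem_filter.1 hX
    have hbad := hF.card_small_defect_le hXF hXr k
    set bad := F.filter fun A => A.card < r ∧ G.key r A = k ∧
      ∑ x ∈ A, G.defectTo x X < 2 * A.card with hbaddef
    have h1 : ∀ A ∈ 𝒜, 2 * A.card ≤ ∑ x ∈ A, G.defectTo x X + if A ∈ bad then 2 * r else 0 := by
      intro A hA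
      obtain ⟨hAF, hAr, hAk⟩ := hmemA A hA
      split_ifs with h
      · omega
      · by_contra hlt
        exact h (by simp only [hbaddef, Finset.mem_filter]; exact ⟨hAF, hAr, hAk, by omega⟩)
    have h2 := Finset.sum_le_sum h1
    rw [Finset.sum_add_distrib, ← Finset.mul_sum] at h2
    have h3 : ∑ A ∈ 𝒜, (if A ∈ bad then 2 * r else 0) ≤ 2 * r ^ 2 := by
      rw [← Finset.sum_filter, Finset.sum_const, smul_eq_mul]
      have : (𝒜.filter fun A => A ∈ bad).card ≤ r :=
        (Finset.card_le_card fun A hA => (Finset.mem_filter.1 hA).2).trans hbad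
      nlinarith
    omega
  have htotal : ∑ A ∈ 𝒜, ∑ x ∈ A, G.defectTo x Finset.univ =
      ∑ X ∈ F, ∑ A ∈ 𝒜, ∑ x ∈ A, G.defectTo x X := by
    rw [Finset.sum_comm]
    refine Finset.sum_congr rfl fun A _ => ?_
    rw [Finset.sum_comm]
    refine Finset.sum_congr rfl fun x _ => ?_
    exact (sum_over_partition hF.disj hcov (fun y => G.defect x y)).symm
  have hupper : ((∑ A ∈ 𝒜, ∑ x ∈ A, G.defectTo x Finset.univ : ℕ) : ℝ) ≤
      s * (2 * (1 / r + η) * n) := by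
    push_cast
    rw [hs]
    push_cast
    rw [Finset.sum_mul]
    refine Finset.sum_le_sum fun A _ => ?_
    rw [← nsmul_eq_mul]
    exact Finset.sum_le_card_nsmul _ _ _ fun x _ => hdeg x
  have hlower : 2 * 𝒜.card * ∑ T ∈ Fle, T.card + Fr.card * (2 * s) ≤
      ∑ A ∈ 𝒜, ∑ x ∈ A, G.defectTo x Finset.univ + Fr.card * (2 * r ^ 2) := by
    rw [htotal, hsplit]
    have h1 := Finset.sum_le_sum hle
    have h2 := Finset.sum_le_sum hreq
    rw [← Finset.mul_sum] at h1
    rw [Finset.sum_add_distrib, Finset.sum_const, Finset.sum_const, smul_eq_mul, smul_eq_mul] at h2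
    omega
  have hsm : s ≤ 𝒜.card * (r - 1) := by
    rw [← smul_eq_mul]
    exact Finset.sum_le_card_nsmul _ _ _ fun A hA => by have := (hmemA A hA).2.1; omega
  have hsmR : (s : ℝ) ≤ 𝒜.card * (r - 1) := by
    have : ((r - 1 : ℕ) : ℝ) = r - 1 := by push_cast [Nat.cast_sub hr]; ring
    rw [← this]
    exact_mod_cast hsm
  have hlowerR : (2 * 𝒜.card * (∑ T ∈ Fle, T.card : ℕ) + Fr.card * (2 * s) : ℝ) ≤
      (∑ A ∈ 𝒜, ∑ x ∈ A, G.defectTo x Finset.univ : ℕ) + Fr.card * (2 * r ^ 2) := by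
    exact_mod_cast hlower
  have hnR : (n : ℝ) = r * Fr.card + ((∑ T ∈ Fle, T.card : ℕ) + (∑ T ∈ Fgt, T.card : ℕ)) := by
    exact_mod_cast hnsum
  exact step_arith (by exact_mod_cast hr) hη (Nat.cast_nonneg _) (Nat.cast_nonneg _)
    (Nat.cast_nonneg _) (Nat.cast_nonneg _) hsmR hnR (hlowerR.trans (add_le_add_left hupper _))

/-- The constant obtained by iterating `leftover_step`. -/
def leftoverConst (r : ℕ) : ℕ → ℝ
  | 0 => 0
  | j + 1 => (r + 1) * leftoverConst r j + 2 * r ^ 2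

lemma leftoverConst_nonneg (r j : ℕ) : 0 ≤ leftoverConst r j := by
  induction j with
  | zero => simp [leftoverConst]
  | succ j ih => simp only [leftoverConst]; positivity

/-- If `m ≤ 1 / η`, the class has at most `r / η ≤ η * n` vertices. Otherwise the error `r ^ 2 * n`
is at most `m * r ^ 2 * η * n` and `m` cancels. -/
lemma leftover_arith {r η n M m s L : ℝ} (hr : 1 ≤ r) (hη : 0 < η) (hn0 : 0 ≤ n) (hM : 0 ≤ M)
    (hm0 : 0 ≤ m) (hn : r / η ^ 2 ≤ n) (hsL : s ≤ L) (hsm : s ≤ m * r)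
    (hstep : m * L ≤ m * (r * M + r ^ 2 * η * n) + r ^ 2 * n) :
    s ≤ r * M + 2 * r ^ 2 * (η * n) := by
  have hηn : 0 ≤ η * n := by positivity
  rcases le_or_gt (m * η) 1 with hm | hm
  · rw [div_le_iff₀ (by positivity)] at hn
    have h2 : s * η ≤ (η * n) * η := by nlinarith
    have h3 : s ≤ η * n := le_of_mul_le_mul_right h2 hη
    have h4 : 0 ≤ r * M := by positivity
    nlinarith
  · have hm0 : 0 < m := hm0.lt_of_ne (by rintro rfl; linarith)
    have h1 : r ^ 2 * n * 1 ≤ r ^ 2 * n * (m * η) :=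
      mul_le_mul_of_nonneg_left hm.le (by positivity)
    have h2 : m * L ≤ m * (r * M + 2 * r ^ 2 * (η * n)) := by linarith
    exact hsL.trans (le_of_mul_le_mul_left h2 hm0)

lemma IsOptimal.leftover_le {r : ℕ} (hr : 0 < r) {F : Finset (Finset V)}
    (hF : G.IsOptimal r F) {η : ℝ} (hη : 0 < η)
    (hdeg : ∀ x, (G.defectTo x Finset.univ : ℝ) ≤ 2 * (1 / r + η) * Fintype.card V)
    (hn : r / η ^ 2 ≤ (Fintype.card V : ℝ)) :
    ((∑ T ∈ F.filter (fun A => A.card < r), T.card : ℕ) : ℝ) ≤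
      leftoverConst r (4 * (r + 1) * r + 1) * η * Fintype.card V := by
  set K := 4 * (r + 1) * r with hK
  set n := Fintype.card V
  have hn0 : (0 : ℝ) ≤ n := by positivity
  have hr1 : (1 : ℝ) ≤ r := by exact_mod_cast hr
  -- Induction downwards over the key, from above the largest possible value. `M` is what the larger
  -- keys contribute.
  have main : ∀ j k, k + j = K + 1 →
      ((∑ T ∈ F.filter (fun A => A.card < r ∧ k ≤ G.key r A), T.card : ℕ) : ℝ) ≤
        leftoverConst r j * η * n := by
    intro j
    induction j with
    | zero =>
      intro k hk
      rw [Finset.filter_false_of_mem]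
      · simp [leftoverConst]
      · rintro A hA ⟨-, hA'⟩
        have := key_le (G := G) (hF.card_le A hA)
        omega
    | succ j ih =>
      intro k hk
      have hM := ih (k + 1) (by omega)
      have hstep := hF.leftover_step hr hdeg hη.le k
      have hlt : (F.filter fun A => A.card < r ∧ k + 1 ≤ G.key r A) =
          F.filter fun A => A.card < r ∧ k < G.key r A :=
        Finset.filter_congr fun A _ => by rw [Nat.succ_le_iff]
      rw [hlt] at hM
      set M := ∑ T ∈ F.filter (fun A => A.card < r ∧ k < G.key r A), T.card
      have hsplit : ∑ T ∈ F.filter (fun A => A.card < r ∧ k ≤ G.key r A), T.card =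
          ∑ T ∈ F.filter (fun A => A.card < r ∧ G.key r A = k), T.card + M := by
        rw [← Finset.sum_filter_add_sum_filter_not
          (F.filter (fun A => A.card < r ∧ k ≤ G.key r A)) (fun A => G.key r A = k),
          Finset.filter_filter, Finset.filter_filter]
        congr 1
        · exact Finset.sum_congr (Finset.filter_congr fun A _ => by
            constructor <;> intro h <;> omega) fun _ _ => rfl
        · exact Finset.sum_congr (Finset.filter_congr fun A _ => by
            constructor <;> intro h <;> omega) fun _ _ => rfl
      have hsub : ∑ T ∈ F.filter (fun A => A.card < r ∧ G.key r A = k), T.card ≤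
          ∑ T ∈ F.filter (fun A => A.card < r ∧ G.key r A ≤ k), T.card :=
        Finset.sum_le_sum_of_subset fun A => by
          simp only [Finset.mem_filter]
          rintro ⟨h1, h2, h3⟩
          exact ⟨h1, h2, h3.le⟩
      have hsm : ∑ T ∈ F.filter (fun A => A.card < r ∧ G.key r A = k), T.card ≤
          (F.filter (fun A => A.card < r ∧ G.key r A = k)).card * r := by
        rw [← smul_eq_mul]
        exact Finset.sum_le_card_nsmul _ _ _ fun A hA => (Finset.mem_filter.1 hA).2.1.le
      rw [hsplit]
      set m := (F.filter (fun A => A.card < r ∧ G.key r A = k)).card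
      set s := ∑ T ∈ F.filter (fun A => A.card < r ∧ G.key r A = k), T.card
      set L := ∑ T ∈ F.filter (fun A => A.card < r ∧ G.key r A ≤ k), T.card
      have hsubR : (s : ℝ) ≤ L := by exact_mod_cast hsub
      have hsmR : (s : ℝ) ≤ m * r := by exact_mod_cast hsm
      have hs : (s : ℝ) ≤ r * M + 2 * r ^ 2 * (η * n) :=
        leftover_arith hr1 hη hn0 (Nat.cast_nonneg _) (Nat.cast_nonneg _) hn hsubR hsmR hstep
      have h5 := mul_le_mul_of_nonneg_left hM (by positivity : (0 : ℝ) ≤ r + 1)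
      push_cast
      simp only [leftoverConst]
      linarith
  have := main (K + 1) 0 (by omega)
  simpa using this

/-- Almost all vertices can be covered by disjoint near-full cliques of size `r`. -/
lemma exists_almost_tiling {r : ℕ} (hr : 0 < r) {η : ℝ} (hη : 0 < η)
    (hdeg : ∀ x, (G.defectTo x Finset.univ : ℝ) ≤ 2 * (1 / r + η) * Fintype.card V)
    (hn : r / η ^ 2 ≤ (Fintype.card V : ℝ)) :
    ∃ F : Finset (Finset V), (F : Set (Finset V)).PairwiseDisjoint id ∧
      (∀ T ∈ F, G.IsNearFull T ∧ T.card = r) ∧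
      (Fintype.card V : ℝ) - r * F.card ≤
        leftoverConst r (4 * (r + 1) * r + 1) * η * Fintype.card V := by
  obtain ⟨F, hF⟩ := G.exists_isOptimal r
  refine ⟨F.filter fun A => A.card = r, hF.disj.subset (Finset.coe_subset.2 (Finset.filter_subset _ _)), fun T hT => ?_, ?_⟩
  · obtain ⟨h1, h2⟩ := Finset.mem_filter.1 hT
    exact ⟨hF.nearFull T h1, h2⟩
  · have h := hF.leftover_le hr hη hdeg hn
    have h1 := sum_over_partition hF.disj (hF.exists_mem hr) (fun _ => 1)
    simp only [Finset.sum_const, smul_eq_mul, mul_one, Finset.card_univ] at h1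
    rw [← Finset.sum_filter_add_sum_filter_not F (fun A => A.card < r)] at h1
    have h2 : (F.filter fun A => ¬ A.card < r) = F.filter fun A => A.card = r :=
      Finset.filter_congr fun A hA => by
        have := hF.card_le A hA
        omega
    rw [h2, Finset.sum_congr rfl (fun T hT => (Finset.mem_filter.1 hT).2), Finset.sum_const,
      smul_eq_mul] at h1
    have h3 : (Fintype.card V : ℝ) = (∑ T ∈ F.filter (fun A => A.card < r), T.card : ℕ) +
        (F.filter fun A => A.card = r).card * r := by exact_mod_cast h1.symm
    linarith

end Leftover

/-! ### Absorbing one vertex into at most three cliques. -/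

section Absorb

variable {V : Type*} [DecidableEq V]

/-- The vertex `v` together with at most three members of `𝓑` can be partitioned into cliques of
the required kind. -/
def Absorbs (G : StdMultigraph V) (r : ℕ) (𝓑 : Finset (Finset V)) (v : V) : Prop :=
  ∃ 𝓒 ⊆ 𝓑, 𝓒.card ≤ 3 ∧ ∃ 𝓣 : Finset (Finset V),
    (𝓣 : Set (Finset V)).PairwiseDisjoint id ∧
    (∀ T ∈ 𝓣, G.IsPathClique T ∧ (T.card = r ∨ T.card = r + 1)) ∧
    𝓣.biUnion id = insert v (𝓒.biUnion id)

/-- A family of disjoint near-full cliques of size `r` in which no two members can be replaced by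
two cliques on the same vertices with fewer light edges. -/
structure IsTightFamily (G : StdMultigraph V) (r : ℕ) (𝓑 : Finset (Finset V)) : Prop where
  disj : (𝓑 : Set (Finset V)).PairwiseDisjoint id
  nearFull : ∀ B ∈ 𝓑, G.IsNearFull B
  card_eq : ∀ B ∈ 𝓑, B.card = r
  cost_le : ∀ B ∈ 𝓑, ∀ C ∈ 𝓑, B ≠ C → ∀ B' C', G.IsNearFull B' → G.IsNearFull C' →
    B'.card = r → C'.card = r → Disjoint B' C' → B' ∪ C' = B ∪ C →
    G.cost B + G.cost C ≤ G.cost B' + G.cost C'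

variable {G : StdMultigraph V} {r : ℕ} {𝓑 : Finset (Finset V)} {v : V}

lemma IsTightFamily.subset (h : G.IsTightFamily r 𝓑) {𝓑' : Finset (Finset V)} (hs : 𝓑' ⊆ 𝓑) :
    G.IsTightFamily r 𝓑' where
  disj := h.disj.subset (Finset.coe_subset.2 hs)
  nearFull B hB := h.nearFull B (hs hB)
  card_eq B hB := h.card_eq B (hs hB)
  cost_le B hB C hC := h.cost_le B (hs hB) C (hs hC)

lemma card_insert_erase {B : Finset V} {x b : V} (hx : x ∉ B) (hb : b ∈ B) :
    (insert x (B.erase b)).card = B.card := by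
  rw [Finset.card_insert_of_notMem (fun h => hx (Finset.mem_of_mem_erase h)),
    Finset.card_erase_add_one hb]

lemma IsTightFamily.absorbs_one (h : G.IsTightFamily r 𝓑) (hv : ∀ B ∈ 𝓑, v ∉ B) {B : Finset V}
    (hB : B ∈ 𝓑) (h1 : G.defectTo v B ≤ 1) : G.Absorbs r 𝓑 v := by
  refine ⟨{B}, by simpa using hB, by simp, {insert v B}, by simp, ?_, by simp⟩
  intro T hT
  rw [Finset.mem_singleton.1 hT]
  exact ⟨(h.nearFull B hB).isPathClique_insert (hv B hB) h1,
    Or.inr (by rw [Finset.card_insert_of_notMem (hv B hB), h.card_eq B hB])⟩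

lemma absorbs_of_pair {B C : Finset V}
    (hB : B ∈ 𝓑) (hC : C ∈ 𝓑) {S T : Finset V} (hS : G.IsPathClique S)
    (hT : G.IsPathClique T) (hSr : S.card = r ∨ S.card = r + 1)
    (hTr : T.card = r ∨ T.card = r + 1) (hST : Disjoint S T)
    (hun : S ∪ T = insert v (B ∪ C)) : G.Absorbs r 𝓑 v := by
  refine ⟨{B, C}, ?_, Finset.card_le_two.trans (by norm_num), {S, T}, ?_, ?_, ?_⟩
  · intro X hX
    rcases Finset.mem_insert.1 hX with rfl | hX
    · exact hB
    · rwa [Finset.mem_singleton.1 hX]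
  · rw [Finset.coe_pair]
    exact Set.pairwise_pair.2 fun _ => ⟨hST, hST.symm⟩
  · intro X hX
    rcases Finset.mem_insert.1 hX with rfl | hX
    · exact ⟨hS, hSr⟩
    · rw [Finset.mem_singleton.1 hX]
      exact ⟨hT, hTr⟩
  · simpa using hun

lemma IsTightFamily.notMem (h : G.IsTightFamily r 𝓑) {B C : Finset V}
    (hB : B ∈ 𝓑) (hC : C ∈ 𝓑) (hBC : B ≠ C) {x : V} (hx : x ∈ B) : x ∉ C :=
  Finset.disjoint_left.1 (h.disj hB hC hBC) hx

lemma IsTightFamily.absorbs_two (h : G.IsTightFamily r 𝓑) (hv : ∀ B ∈ 𝓑, v ∉ B) {B C : Finset V}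
    (hB : B ∈ 𝓑) (hC : C ∈ 𝓑) (hBC : B ≠ C) {b : V} (hb : b ∈ B)
    (h1 : G.defectTo v (B.erase b) ≤ 1) (h2 : G.defectTo b C ≤ 1) : G.Absorbs r 𝓑 v := by
  have hvB := hv B hB
  have hvC := hv C hC
  have hbC := h.notMem hB hC hBC hb
  have hd : ∀ x ∈ B, x ∉ C := fun x hx => h.notMem hB hC hBC hx
  refine absorbs_of_pair hB hC
    (((h.nearFull B hB).subset (Finset.erase_subset b B)).isPathClique_insert
      (fun h => hvB (Finset.mem_of_mem_erase h)) h1)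
    ((h.nearFull C hC).isPathClique_insert hbC h2)
    (Or.inl ?_) (Or.inr ?_) ?_ ?_
  · rw [card_insert_erase hvB hb, h.card_eq B hB]
  · rw [Finset.card_insert_of_notMem hbC, h.card_eq C hC]
  · rw [Finset.disjoint_left]
    grind
  · ext x
    grind

/-- A chain: `v` replaces `b` in `B`, `b` replaces `c` in `C`, and `c` enlarges `D`. -/
lemma IsTightFamily.absorbs_three (h : G.IsTightFamily r 𝓑) (hv : ∀ B ∈ 𝓑, v ∉ B)
    {B C D : Finset V}
    (hB : B ∈ 𝓑) (hC : C ∈ 𝓑) (hD : D ∈ 𝓑) (hBC : B ≠ C) (hBD : B ≠ D) (hCD : C ≠ D)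
    {b c : V} (hb : b ∈ B) (hc : c ∈ C)
    (h1 : G.defectTo v (B.erase b) ≤ 1) (h2 : G.defectTo b (C.erase c) ≤ 1)
    (h3 : G.defectTo c D ≤ 1) : G.Absorbs r 𝓑 v := by
  have hvB := hv B hB
  have hvC := hv C hC
  have hvD := hv D hD
  have hbC := h.notMem hB hC hBC hb
  have hcD := h.notMem hC hD hCD hc
  have hd1 : ∀ x ∈ B, x ∉ C := fun x hx => h.notMem hB hC hBC hx
  have hd2 : ∀ x ∈ B, x ∉ D := fun x hx => h.notMem hB hD hBD hx
  have hd3 : ∀ x ∈ C, x ∉ D := fun x hx => h.notMem hC hD hCD hx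
  have e1 : Disjoint (insert v (B.erase b)) (insert b (C.erase c)) := by
    rw [Finset.disjoint_left]; grind
  have e2 : Disjoint (insert v (B.erase b)) (insert c D) := by
    rw [Finset.disjoint_left]; grind
  have e3 : Disjoint (insert b (C.erase c)) (insert c D) := by
    rw [Finset.disjoint_left]; grind
  refine ⟨{B, C, D}, ?_, Finset.card_le_three,
    {insert v (B.erase b), insert b (C.erase c), insert c D}, ?_, ?_, ?_⟩
  · intro X hX
    simp only [Finset.mem_insert, Finset.mem_singleton] at hX
    rcases hX with rfl | rfl | rfl <;> assumption
  · intro X hX Y hY hXY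
    simp only [Finset.coe_insert, Finset.coe_singleton, Set.mem_insert_iff,
      Set.mem_singleton_iff] at hX hY
    simp only [Function.onFun, id]
    rcases hX with rfl | rfl | rfl <;> rcases hY with rfl | rfl | rfl <;>
      first
      | exact absurd rfl hXY
      | assumption
      | (apply Disjoint.symm; assumption)
  · intro X hX
    simp only [Finset.mem_insert, Finset.mem_singleton] at hX
    rcases hX with rfl | rfl | rfl
    · exact ⟨((h.nearFull B hB).subset (Finset.erase_subset b B)).isPathClique_insert
        (fun h => hvB (Finset.mem_of_mem_erase h)) h1,
        Or.inl (by rw [card_insert_erase hvB hb, h.card_eq B hB])⟩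
    · exact ⟨((h.nearFull C hC).subset (Finset.erase_subset c C)).isPathClique_insert
        (fun h => hbC (Finset.mem_of_mem_erase h)) h2,
        Or.inl (by rw [card_insert_erase hbC hc, h.card_eq C hC])⟩
    · exact ⟨(h.nearFull D hD).isPathClique_insert hcD h3,
        Or.inr (by rw [Finset.card_insert_of_notMem hcD, h.card_eq D hD])⟩
  · ext x
    simp only [Finset.mem_biUnion, Finset.mem_insert, Finset.mem_singleton, id]
    simp only [exists_eq_or_imp, exists_eq_left, Finset.mem_insert, Finset.mem_erase]
    grind

/-- The defect of an exchangeable vertex is dominated by that of the vertex replacing it. -/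
lemma IsTightFamily.defect_le_of_not_absorbs (h : G.IsTightFamily r 𝓑) (hv : ∀ B ∈ 𝓑, v ∉ B)
    (hna : ¬ G.Absorbs r 𝓑 v) {B C : Finset V} (hB : B ∈ 𝓑) (hC : C ∈ 𝓑) (hBC : B ≠ C)
    {b y : V} (hb : b ∈ B) (hy : y ∈ C) (hvb : G.defect v b ≠ 0) (hvB2 : G.defectTo v B = 2)
    (hp : ∀ p ∈ B, G.defect v p ≠ 0 → G.defectTo p C = 2)
    (hq : ∀ q ∈ C, G.defect b q ≠ 0 → G.defectTo q B = 2) :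
    G.defect b y ≤ G.defect v y := by
  by_contra! hlt
  have hvB := hv B hB
  have hvC := hv C hC
  have hd : ∀ x ∈ B, x ∉ C := fun x hx => h.notMem hB hC hBC hx
  have hbC := hd b hb
  have hyB : y ∉ B := fun hyB => hd y hyB hy
  have hbC2 := hp b hb hvb
  have hyB2 := hq y hy (by omega)
  have hNB := h.nearFull B hB
  have hNC := h.nearFull C hC
  have hvZ := G.defectTo_erase v hb
  have hyZ := G.defectTo_erase y hb
  have hbC' := G.defectTo_erase b hy
  have hvy : v ≠ y := fun e => hvC (e ▸ hy)
  have hby : b ≠ y := fun e => hyB (e ▸ hb)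
  have cyb := G.defect_comm y b
  have cyv := G.defect_comm y v
  have hvn : v ∉ B.erase b := fun e => hvB (Finset.mem_of_mem_erase e)
  have hyn : y ∉ B.erase b := fun e => hyB (Finset.mem_of_mem_erase e)
  have hbn : b ∉ C.erase y := fun e => hbC (Finset.mem_of_mem_erase e)
  have hcB := h.card_eq B hB
  have hcC := h.card_eq C hC
  have hcB1 := Finset.card_erase_add_one hb
  have hcC1 := Finset.card_erase_add_one hy
  have hNZ := hNB.subset (Finset.erase_subset b B)
  have hNZ' := hNC.subset (Finset.erase_subset y C)
  -- First attempt: `b` and `y` change places and `v` joins `B`. Since `y` has defect 2 to `B` and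
  -- its defect to `b` exceeds that to `v`, its defect to `B.erase b` and `v` together is at most 1.
  -- Only a matched vertex `p` light to both `v` and `y` obstructs this.
  by_cases hcase : ∃ p ∈ B.erase b, G.defect v p ≠ 0 ∧ G.defect y p ≠ 0 ∧
      3 ≤ G.defectTo p (B.erase b)
  swap
  · refine hna (absorbs_of_pair hB hC
      (hNZ.isPathClique_insert_insert hvn hyn hvy (by omega)
        (by rw [G.defectTo_insert y hvn]; omega) hcase)
      (hNZ'.isPathClique_insert hbn (by omega))
      (Or.inr ?_) (Or.inl ?_) ?_ ?_)
    · rw [Finset.card_insert_of_notMem (by simp [hvy.symm, hyB]),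
        Finset.card_insert_of_notMem hvn]
      omega
    · rw [Finset.card_insert_of_notMem hbn]
      omega
    · rw [Finset.disjoint_left]
      grind
    · ext x
      grind
  obtain ⟨p, hpZ, hvp, hyp, hp3⟩ := hcase
  have hpB := Finset.mem_of_mem_erase hpZ
  have hpb : p ≠ b := Finset.ne_of_mem_erase hpZ
  have hpC := hd p hpB
  have hpy : p ≠ y := fun e => hyB (e ▸ hpB)
  have hpC2 := hp p hpB hvp
  have hpC' := G.defectTo_erase p hy
  have hpB' := G.defectTo_erase p hb
  have hpB3 := hNB p hpB
  have cpy := G.defect_comm p y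
  have cbp := G.defect_comm b p
  have hvZp := G.defectTo_erase v hpZ
  have hyZp := G.defectTo_erase y hpZ
  -- The vertex `p` uses up the defect of both `v` and `y` to `B.erase b`, so both are clean to `Z`.
  -- Also `p` and `b` are joined by a heavy edge. Second attempt: move `p` to `C` along with `b`.
  set Z := (B.erase b).erase p with hZ
  have hNZp : G.IsNearFull Z := hNZ.subset (Finset.erase_subset _ _)
  have hcZ := Finset.card_erase_add_one hpZ
  rw [← hZ] at hcZ
  have hyZ0 : G.defectTo y Z = 0 := by omega
  have hvZ0 : G.defectTo v Z = 0 := by omega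
  have hpn : p ∉ insert b (C.erase y) := by simp [hpb, hpC]
  have hyZn : y ∉ Z := fun e => hyn (Finset.mem_of_mem_erase e)
  have hvZn : v ∉ Z := fun e => hvn (Finset.mem_of_mem_erase e)
  have hclean : ∀ {x : V} {Y : Finset V}, G.IsNearFull Y → x ∉ Y → G.defectTo x Y = 0 →
      G.IsNearFull (insert x Y) := fun hY hx h0 =>
    hY.insert_of_free hx (by omega) fun z hz hz' => absurd ((G.defectTo_eq_zero).1 h0 z hz) hz'
  by_cases hcase2 : ∃ q ∈ C.erase y, G.defect b q ≠ 0 ∧ G.defect p q ≠ 0 ∧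
      3 ≤ G.defectTo q (C.erase y)
  swap
  · have hN1 : G.IsNearFull (insert y (insert v Z)) := by
      refine hclean (hclean hNZp hvZn hvZ0) (by simp [hvy.symm, hyZn]) ?_
      rw [G.defectTo_insert y hvZn]
      omega
    refine hna (absorbs_of_pair hB hC hN1.isPathClique
      (hNZ'.isPathClique_insert_insert hbn (fun e => hpC (Finset.mem_of_mem_erase e)) hpb.symm
        (by omega) (by rw [G.defectTo_insert p hbn]; omega) hcase2)
      (Or.inl ?_) (Or.inr ?_) ?_ ?_)
    · rw [Finset.card_insert_of_notMem (by simp [hvy.symm, hyZn]),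
        Finset.card_insert_of_notMem hvZn]
      omega
    · rw [Finset.card_insert_of_notMem hpn, Finset.card_insert_of_notMem hbn]
      omega
    · rw [Finset.disjoint_left]
      grind
    · ext x
      grind
  obtain ⟨q, hqC', hbq, hpq, hq3⟩ := hcase2
  have hqC := Finset.mem_of_mem_erase hqC'
  have hqy : q ≠ y := Finset.ne_of_mem_erase hqC'
  have hqB : q ∉ B := fun e => hd q e hqC
  have hqB2 := hq q hqC hbq
  have hqB' := G.defectTo_erase q hb
  have hqB'' := G.defectTo_erase q hpZ
  have hqCy := G.defectTo_erase q hy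
  have hqC3 := hNC q hqC
  have cqb := G.defect_comm q b
  have cqp := G.defect_comm q p
  have cqy := G.defect_comm q y
  have hbCq := G.defectTo_erase b hqC'
  have hpCq := G.defectTo_erase p hqC'
  rw [← hZ] at hqB''
  set Y := (C.erase y).erase q with hY
  have hNY : G.IsNearFull Y := hNZ'.subset (Finset.erase_subset _ _)
  have hcY := Finset.card_erase_add_one hqC'
  rw [← hY] at hcY
  have hqZn : q ∉ Z := fun e => hqB (Finset.mem_of_mem_erase (Finset.mem_of_mem_erase e))
  have hbYn : b ∉ Y := fun e => hbC (Finset.mem_of_mem_erase (Finset.mem_of_mem_erase e))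
  have hpYn : p ∉ Y := fun e => hpC (Finset.mem_of_mem_erase (Finset.mem_of_mem_erase e))
  have hqyZ : q ∉ insert y Z := by simp [hqy, hqZn]
  have hpbY : p ∉ insert b Y := by simp [hpb, hpYn]
  have d1 : G.defectTo q (insert y Z) = 0 := by
    rw [G.defectTo_insert q hyZn]; omega
  have d2 : G.defectTo b Y = 0 := by omega
  have d3 : G.defectTo p (insert b Y) = 0 := by
    rw [G.defectTo_insert p hbYn]; omega
  -- Both attempts being obstructed, exchange `b`, `p` with `y`, `q`. The inserted vertices create
  -- no light edge, while the partner edges of `p` and `q` disappear, which contradicts tightness.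
  have hle := h.cost_le B hB C hC hBC (insert q (insert y Z)) (insert p (insert b Y))
    (hclean (hclean hNZp hyZn hyZ0) hqyZ d1) (hclean (hclean hNY hbYn d2) hpbY d3)
    (by rw [Finset.card_insert_of_notMem hqyZ, Finset.card_insert_of_notMem hyZn]; omega)
    (by rw [Finset.card_insert_of_notMem hpbY, Finset.card_insert_of_notMem hbYn]; omega)
    (by rw [Finset.disjoint_left]; grind) (by ext x; grind)
  rw [cost_insert hqyZ, cost_insert hyZn, cost_insert hpbY, cost_insert hbYn, d1, d2, d3,
    hyZ0] at hle
  have f1 := cost_insert (G := G) (Finset.notMem_erase b B)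
  have f2 := cost_insert (G := G) (Finset.notMem_erase p (B.erase b))
  have f3 := cost_insert (G := G) (Finset.notMem_erase y C)
  have f4 := cost_insert (G := G) (Finset.notMem_erase q (C.erase y))
  have g1 := G.defectTo_erase p hpZ
  have g2 := G.defectTo_erase q hqC'
  rw [Finset.insert_erase hb] at f1
  rw [Finset.insert_erase hpZ, ← hZ] at f2
  rw [Finset.insert_erase hy] at f3
  rw [Finset.insert_erase hqC', ← hY] at f4
  rw [← hZ, defect_self] at g1
  rw [← hY, defect_self] at g2
  omega

end Absorb

/-! ### Recognising the extremal structure around one vertex. -/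

section Extremal

variable {V : Type*} [DecidableEq V] [Fintype V] {G : StdMultigraph V}

/-- If the vertices with positive defect to `v` have nearly the same defects as `v`, the
multigraph is extremal. -/
lemma isExtremal_of_uniform {r : ℕ} {γ κ n M : ℝ} (hn : n = Fintype.card V) (hn0 : 0 < n)
    (v : V) (S₁ S₂ : Finset V) (h1 : ∀ z ∈ S₁, G.defect v z = 1)
    (h2 : ∀ z ∈ S₂, G.defect v z = 2)
    (hdiff : ∀ z ∈ S₁ ∪ S₂,
      ((Finset.univ.filter fun y => G.defect z y ≠ G.defect v y).card : ℝ) ≤ κ * n)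
    (hM : (S₁.card : ℝ) + 2 * S₂.card = 2 * M) (hγ : 2 * |M - n / r| + 4 * κ * n < γ * n)
    (hκ : 2 * κ < γ) (hκ0 : 0 < κ) : G.IsExtremal r γ := by
  set s₁ := (S₁.card : ℝ) with hs₁
  set s₂ := (S₂.card : ℝ) with hs₂
  have hs₁n : s₁ ≤ n := by rw [hn]; exact Nat.cast_le.2 (Finset.card_le_univ S₁)
  have hs₂n : s₂ ≤ n := by rw [hn]; exact Nat.cast_le.2 (Finset.card_le_univ S₂)
  have hs₁0 : 0 ≤ s₁ := by positivity
  have hs₂0 : 0 ≤ s₂ := by positivity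
  have habs := abs_le.1 (le_refl |M - n / r|)
  have habs0 := abs_nonneg (M - n / r)
  have hn2 : 2 * κ * n ^ 2 < γ * n ^ 2 := mul_lt_mul_of_pos_right hκ (by positivity)
  -- For `z` in `S₁` and `y` in `S₂`, the symmetric defect of `z`, `y` cannot equal both `G.defect v
  -- y = 2` and `G.defect v z = 1`. So each such pair is a disagreement, and there are few of these.
  have hsmall : s₁ ≤ 2 * κ * n ∨ s₂ ≤ 2 * κ * n := by
    by_contra! hcon
    obtain ⟨c1, c2⟩ := hcon
    have hpair : S₁.card * S₂.card ≤
        ∑ z ∈ S₁, (Finset.univ.filter fun y => G.defect z y ≠ G.defect v y).card +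
        ∑ z ∈ S₂, (Finset.univ.filter fun y => G.defect z y ≠ G.defect v y).card := by
      have e1 : ∑ z ∈ S₁, ∑ y ∈ S₂, 1 ≤
          ∑ z ∈ S₁, ∑ y ∈ S₂, ((if G.defect z y ≠ G.defect v y then 1 else 0) +
            if G.defect y z ≠ G.defect v z then 1 else 0) := by
        refine Finset.sum_le_sum fun z hz => Finset.sum_le_sum fun y hy => ?_
        have a1 := h1 z hz
        have a2 := h2 y hy
        have a3 := G.defect_comm z y
        split_ifs <;> omega
      have e2 : ∀ z : V, ∀ S : Finset V, ∑ y ∈ S, (if G.defect z y ≠ G.defect v y then 1 else 0) ≤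
          (Finset.univ.filter fun y => G.defect z y ≠ G.defect v y).card := by
        intro z S
        rw [Finset.card_filter]
        exact Finset.sum_le_sum_of_subset (Finset.subset_univ S)
      simp only [Finset.sum_add_distrib] at e1
      rw [Finset.sum_comm (s := S₁) (t := S₂)
        (f := fun z y => if G.defect y z ≠ G.defect v z then 1 else 0)] at e1
      simp only [Finset.sum_const, smul_eq_mul, mul_one] at e1
      exact e1.trans (add_le_add (Finset.sum_le_sum fun z _ => e2 z S₂)
        (Finset.sum_le_sum fun z _ => e2 z S₁))
    have hpairR : s₁ * s₂ ≤ s₁ * (κ * n) + s₂ * (κ * n) := by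
      have e1 : ∀ S ⊆ S₁ ∪ S₂, ((∑ z ∈ S, (Finset.univ.filter fun y =>
          G.defect z y ≠ G.defect v y).card : ℕ) : ℝ) ≤ S.card * (κ * n) := by
        intro S hS
        push_cast
        rw [← nsmul_eq_mul]
        exact Finset.sum_le_card_nsmul _ _ _ fun z hz => hdiff z (hS hz)
      have e2 := (Nat.cast_le (α := ℝ)).2 hpair
      rw [Nat.cast_mul, Nat.cast_add] at e2
      exact e2.trans (add_le_add (e1 S₁ Finset.subset_union_left)
        (e1 S₂ Finset.subset_union_right))
    have hκn : 0 < 2 * κ * n := by positivity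
    have c3 := mul_lt_mul_of_pos_left c2 (hκn.trans c1)
    have c4 := mul_lt_mul_of_pos_left c1 (hκn.trans c2)
    linarith
  rcases hsmall with hsmall | hsmall
  · refine Or.inl ⟨S₂, ?_, ?_⟩
    · rw [← hn, abs_lt]
      constructor <;> linarith [habs.1, habs.2]
    · rw [← hn]
      have e1 : (G.induce S₂).edgeCount ≤ ∑ z ∈ S₂,
          2 * (Finset.univ.filter fun y => G.defect z y ≠ G.defect v y).card := by
        refine (edgeCount_induce_le S₂).trans (Finset.sum_le_sum fun z hz => ?_)
        rw [Finset.card_filter, Finset.mul_sum]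
        refine (Finset.sum_le_sum fun y hy => ?_).trans
          (Finset.sum_le_sum_of_subset (Finset.subset_univ S₂))
        have a2 := h2 y hy
        have a3 : G.defect z y = 2 - G.mu z y := rfl
        have a4 := G.le_two z y
        split_ifs <;> omega
      have e2 : ((G.induce S₂).edgeCount : ℝ) ≤ S₂.card * (2 * (κ * n)) := by
        refine (Nat.cast_le.2 e1).trans ?_
        push_cast
        rw [← nsmul_eq_mul]
        exact Finset.sum_le_card_nsmul _ _ _ fun z hz =>
          mul_le_mul_of_nonneg_left (hdiff z (Finset.mem_union_right _ hz)) (by norm_num)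
      rw [← hs₂] at e2
      have e3 : s₂ * (2 * (κ * n)) ≤ n * (2 * (κ * n)) :=
        mul_le_mul_of_nonneg_right hs₂n (by positivity)
      nlinarith
  · refine Or.inr ⟨S₁, ?_, ?_⟩
    · rw [← hn, abs_lt, mul_div_assoc]
      constructor <;> linarith [habs.1, habs.2]
    · rw [← hn]
      have e1 : (G.induce S₁).heavyCount ≤ ∑ z ∈ S₁,
          (Finset.univ.filter fun y => G.defect z y ≠ G.defect v y).card := by
        refine (heavyCount_induce_le S₁).trans (Finset.sum_le_sum fun z hz => ?_)
        rw [Finset.card_filter]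
        refine (Finset.sum_le_sum fun y hy => ?_).trans
          (Finset.sum_le_sum_of_subset (Finset.subset_univ S₁))
        have a2 := h1 y hy
        have a3 : G.defect z y = 2 - G.mu z y := rfl
        have a4 := G.le_two z y
        split_ifs <;> omega
      have e2 : ((G.induce S₁).heavyCount : ℝ) ≤ S₁.card * (κ * n) := by
        refine (Nat.cast_le.2 e1).trans ?_
        push_cast
        rw [← nsmul_eq_mul]
        exact Finset.sum_le_card_nsmul _ _ _ fun z hz => hdiff z (Finset.mem_union_left _ hz)
      rw [← hs₁] at e2
      have e3 : s₁ * (κ * n) ≤ n * (κ * n) := mul_le_mul_of_nonneg_right hs₁n (by positivity)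
      nlinarith

end Extremal

/-! ### Stuck vertices and their typical defects. -/

section Counting

variable {V : Type*} [Fintype V] {G : StdMultigraph V} {r : ℕ}
  {𝓑 : Finset (Finset V)} {v : V}

variable (G) in
/-- The vertices with defect at most one to only very few members of `𝓑`. -/
def stuck (𝓑 : Finset (Finset V)) : Finset V :=
  Finset.univ.filter fun x => (𝓑.filter fun B => G.defectTo x B ≤ 1).card ≤ 2

variable (G) in
/-- The members of `𝓑` whose defect to `x` is not two. -/
def atypical (𝓑 : Finset (Finset V)) (x : V) : Finset (Finset V) :=
  𝓑.filter fun B => G.defectTo x B ≠ 2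

/-- The threshold 2 in `stuck` is chosen so that the last clique of a chain can avoid the two before
it. -/
lemma exists_of_not_mem_stuck {x : V} (hx : x ∉ G.stuck 𝓑) (B C : Finset V) :
    ∃ D ∈ 𝓑, B ≠ D ∧ C ≠ D ∧ G.defectTo x D ≤ 1 := by
  classical
  simp only [stuck, Finset.mem_filter, Finset.mem_univ, true_and, not_le] at hx
  obtain ⟨D, hD, hD'⟩ := Finset.exists_mem_notMem_of_card_lt_card
    ((Finset.card_le_two (a := B) (b := C)).trans_lt hx)
  simp only [Finset.mem_insert, Finset.mem_singleton, not_or] at hD'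
  obtain ⟨h1, h2⟩ := Finset.mem_filter.1 hD
  exact ⟨D, h1, Ne.symm hD'.1, Ne.symm hD'.2, h2⟩

lemma sum_defectTo_le (hd : (𝓑 : Set (Finset V)).PairwiseDisjoint id) (x : V) :
    ∑ B ∈ 𝓑, G.defectTo x B ≤ G.defectTo x Finset.univ := by
  classical
  have h := Finset.sum_biUnion (f := fun y => G.defect x y) hd
  simp only [id] at h
  rw [show ∑ B ∈ 𝓑, G.defectTo x B = ∑ B ∈ 𝓑, ∑ y ∈ B, G.defect x y from rfl, ← h]
  exact G.defectTo_mono x (Finset.subset_univ _)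

/-- A member with defect above 2 pays for its own atypicality. Each of the at most two members with
defect below 2 falls short by at most 3, which gives the 6. -/
lemma two_mul_card_le {x : V} (hx : x ∈ G.stuck 𝓑) :
    2 * 𝓑.card + (G.atypical 𝓑 x).card ≤ ∑ B ∈ 𝓑, G.defectTo x B + 6 := by
  simp only [stuck, Finset.mem_filter, Finset.mem_univ, true_and] at hx
  rw [Finset.card_filter] at hx
  rw [atypical, Finset.card_filter]
  have h : ∑ B ∈ 𝓑, (2 + if G.defectTo x B ≠ 2 then 1 else 0) ≤
      ∑ B ∈ 𝓑, (G.defectTo x B + 3 * if G.defectTo x B ≤ 1 then 1 else 0) :=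
    Finset.sum_le_sum fun B _ => by split_ifs <;> omega
  rw [Finset.sum_add_distrib, Finset.sum_add_distrib, Finset.sum_const, smul_eq_mul,
    ← Finset.mul_sum] at h
  omega

end Counting

lemma card_lower {r : ℕ} {n ε N : ℝ} (hr : 0 < r) (hn0 : 0 < n) (hε : 0 < ε) (hcov : n - r * N ≤ ε * n) :
    n / r - ε * n ≤ N := by
  have hr1 : (1 : ℝ) ≤ r := by exact_mod_cast hr
  have h1 : n / r - ε * n / r ≤ N := by
    rw [← sub_div, div_le_iff₀ (by positivity)]
    linarith
  have h2 : ε * n / r ≤ ε * n := div_le_self (by positivity) hr1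
  linarith

lemma IsTightFamily.card_biUnion {V : Type*} [DecidableEq V] {G : StdMultigraph V} {r : ℕ}
    {𝓑 : Finset (Finset V)} (h : G.IsTightFamily r 𝓑) {𝓔 : Finset (Finset V)} (h𝓔 : 𝓔 ⊆ 𝓑) :
    (𝓔.biUnion id).card = 𝓔.card * r := by
  rw [Finset.card_biUnion fun B hB C hC hBC => h.disj (h𝓔 hB) (h𝓔 hC) hBC]
  exact Finset.sum_const_nat fun B hB => h.card_eq B (h𝓔 hB)

/-! ### Every uncovered vertex is absorbed unless the multigraph is extremal. -/

section Absorption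

variable {V : Type*} [Fintype V] {G : StdMultigraph V} {r : ℕ}
  {𝓑 : Finset (Finset V)} {v : V} {ε θ γ n : ℝ}

variable (G) in
/-- The members of `𝓑` with defect two to almost all stuck vertices and to `v`. -/
noncomputable def goodMembers (𝓑 : Finset (Finset V)) (v : V) (m : ℝ) : Finset (Finset V) :=
  𝓑.filter fun B => G.defectTo v B = 2 ∧
    (((G.stuck 𝓑).filter fun x => G.defectTo x B ≠ 2).card : ℝ) ≤ m

lemma atypical_card_le (hr : 0 < r) (hn0 : 0 < n)
    (hd : (𝓑 : Set (Finset V)).PairwiseDisjoint id)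
    (hdeg : ∀ x, (G.defectTo x Finset.univ : ℝ) ≤ 2 * (1 / r + ε) * n) (hε : 0 < ε)
    (hcov : n - r * 𝓑.card ≤ ε * n) (hεn : 6 ≤ ε * n) {x : V} (hx : x ∈ G.stuck 𝓑) :
    ((G.atypical 𝓑 x).card : ℝ) ≤ 5 * ε * n := by
  have h1 := two_mul_card_le hx
  have h2 := sum_defectTo_le (G := G) hd x
  have h3 : (2 * 𝓑.card + (G.atypical 𝓑 x).card : ℝ) ≤ G.defectTo x Finset.univ + 6 := by
    exact_mod_cast h1.trans (by omega)
  have h4 := card_lower hr hn0 hε hcov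
  have h5 := hdeg x
  have h6 : 2 * (1 / r + ε) * n = 2 * (n / r) + 2 * (ε * n) := by ring
  linarith

variable [DecidableEq V]

lemma goodMembers_card (hr : 0 < r) (hn : n = Fintype.card V) (hn0 : 0 < n)
    (hd : (𝓑 : Set (Finset V)).PairwiseDisjoint id)
    (hdeg : ∀ x, (G.defectTo x Finset.univ : ℝ) ≤ 2 * (1 / r + ε) * n) (hε : 0 < ε)
    (hcov : n - r * 𝓑.card ≤ ε * n) (hεn : 6 ≤ ε * n) (hθ : 0 < θ) (hθ1 : θ ≤ 1)
    (hεθ : 5 * ε = θ ^ 2) (hv : v ∈ G.stuck 𝓑) :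
    (𝓑.card : ℝ) - 2 * θ * n ≤ (G.goodMembers 𝓑 v (θ * n)).card := by
  have hat : ∀ x ∈ G.stuck 𝓑, ((G.atypical 𝓑 x).card : ℝ) ≤ θ ^ 2 * n := fun x hx =>
    hεθ ▸ atypical_card_le hr hn0 hd hdeg hε hcov hεn hx
  set 𝓝 := 𝓑.filter fun B => θ * n < ((G.stuck 𝓑).filter fun x => G.defectTo x B ≠ 2).card
    with h𝓝
  have hsub : 𝓑 ⊆ G.goodMembers 𝓑 v (θ * n) ∪ (G.atypical 𝓑 v ∪ 𝓝) := by
    intro B hB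
    simp only [goodMembers, atypical, h𝓝, Finset.mem_union, Finset.mem_filter, hB, true_and]
    by_cases h1 : G.defectTo v B = 2
    · rcases le_or_gt (((G.stuck 𝓑).filter fun x => G.defectTo x B ≠ 2).card : ℝ) (θ * n) with h | h
      · exact Or.inl ⟨h1, h⟩
      · exact Or.inr (Or.inr h)
    · exact Or.inr (Or.inl h1)
  have hcard : 𝓑.card ≤ (G.goodMembers 𝓑 v (θ * n)).card + ((G.atypical 𝓑 v).card + 𝓝.card) :=
    (Finset.card_le_card hsub).trans ((Finset.card_union_le _ _).trans
      (Nat.add_le_add_left (Finset.card_union_le _ _) _))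
  have hcardR : (𝓑.card : ℝ) ≤ (G.goodMembers 𝓑 v (θ * n)).card +
      ((G.atypical 𝓑 v).card + 𝓝.card) := by exact_mod_cast hcard
  -- Double counting: at most `θ ^ 2 * n ^ 2` pairs are atypical, so at most `θ * n` members are
  -- atypical for more than `θ * n` stuck vertices.
  have hdc : ∑ B ∈ 𝓝, ((G.stuck 𝓑).filter fun x => G.defectTo x B ≠ 2).card ≤
      ∑ x ∈ G.stuck 𝓑, (G.atypical 𝓑 x).card := by
    simp only [atypical, Finset.card_filter]
    rw [Finset.sum_comm]
    exact Finset.sum_le_sum fun x _ => Finset.sum_le_sum_of_subset (Finset.filter_subset _ _)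
  have h1 : 𝓝.card * (θ * n) ≤ ((∑ B ∈ 𝓝,
      ((G.stuck 𝓑).filter fun x => G.defectTo x B ≠ 2).card : ℕ) : ℝ) := by
    push_cast
    rw [← nsmul_eq_mul]
    exact Finset.card_nsmul_le_sum _ _ _ fun B hB => (Finset.mem_filter.1 hB).2.le
  have h2 : ((∑ x ∈ G.stuck 𝓑, (G.atypical 𝓑 x).card : ℕ) : ℝ) ≤ n * (θ ^ 2 * n) := by
    push_cast
    refine (Finset.sum_le_card_nsmul _ _ _ hat).trans ?_
    rw [nsmul_eq_mul, hn]
    exact mul_le_mul_of_nonneg_right (Nat.cast_le.2 (Finset.card_le_univ _)) (by positivity)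
  have h3 : (𝓝.card : ℝ) * (θ * n) ≤ (θ * n) * (θ * n) := by
    have := (h1.trans (Nat.cast_le.2 hdc)).trans h2
    linarith
  have h4 : (𝓝.card : ℝ) ≤ θ * n := le_of_mul_le_mul_right h3 (by positivity)
  have h5 := hat v hv
  have h6 : θ ^ 2 * n ≤ θ * n := by
    refine mul_le_mul_of_nonneg_right ?_ hn0.le
    nlinarith
  linarith

lemma IsTightFamily.mem_stuck (h : G.IsTightFamily r 𝓑) (hv : ∀ B ∈ 𝓑, v ∉ B)
    (hna : ¬ G.Absorbs r 𝓑 v) : v ∈ G.stuck 𝓑 := by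
  by_contra hcon
  obtain ⟨D, hD, -, -, hvD⟩ := exists_of_not_mem_stuck hcon ∅ ∅
  exact hna (h.absorbs_one hv hD hvD)

/-- Removing `b` lowers the defect of `v` to at most 1. So `v` can replace `b`, and a non-stuck `b`
would find another clique. -/
lemma IsTightFamily.mem_stuck_of_defect (h : G.IsTightFamily r 𝓑) (hv : ∀ B ∈ 𝓑, v ∉ B)
    (hna : ¬ G.Absorbs r 𝓑 v) {B : Finset V} (hB : B ∈ 𝓑) (hvB : G.defectTo v B = 2) {b : V}
    (hb : b ∈ B) (hvb : G.defect v b ≠ 0) : b ∈ G.stuck 𝓑 := by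
  by_contra hcon
  obtain ⟨D, hD, hBD, -, hbD⟩ := exists_of_not_mem_stuck hcon B B
  have := G.defectTo_erase v hb
  exact hna (h.absorbs_two hv hB hD hBD hb (by omega) hbD)

lemma IsTightFamily.mem_stuck_of_defect_of_defect (h : G.IsTightFamily r 𝓑)
    (hv : ∀ B ∈ 𝓑, v ∉ B) (hna : ¬ G.Absorbs r 𝓑 v) {B C : Finset V} (hB : B ∈ 𝓑)
    (hC : C ∈ 𝓑) (hBC : B ≠ C) (hvB : G.defectTo v B = 2) {b q : V}
    (hb : b ∈ B) (hvb : G.defect v b ≠ 0) (hbC : G.defectTo b C = 2) (hq : q ∈ C)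
    (hbq : G.defect b q ≠ 0) : q ∈ G.stuck 𝓑 := by
  by_contra hcon
  obtain ⟨D, hD, hBD, hCD, hqD⟩ := exists_of_not_mem_stuck hcon B C
  have := G.defectTo_erase v hb
  have := G.defectTo_erase b hq
  exact hna (h.absorbs_three hv hB hC hD hBC hBD hCD hb hq (by omega) (by omega) hqD)

/-- The set `Y` consists of the uncovered vertices and the few members where the hypotheses of
`IsTightFamily.defect_le_of_not_absorbs` may fail: `B` itself, members atypical for a non-heavy
neighbour of `v` in `B`, and members containing a stuck vertex whose defect to `B` is not 2. -/
lemma IsTightFamily.exists_exceptional (h : G.IsTightFamily r 𝓑) (hr : 0 < r)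
    (hn : n = Fintype.card V) (hn0 : 0 < n)
    (hdeg : ∀ x, (G.defectTo x Finset.univ : ℝ) ≤ 2 * (1 / r + ε) * n) (hε : 0 < ε)
    (hcov : n - r * 𝓑.card ≤ ε * n) (hεn : 6 ≤ ε * n) (hθ : 0 < θ) (hθ1 : θ ≤ 1)
    (hεθ : 5 * ε = θ ^ 2) (hrθ : r ≤ θ * n)
    (hv : ∀ B ∈ 𝓑, v ∉ B) (hna : ¬ G.Absorbs r 𝓑 v) {B : Finset V}
    (hB : B ∈ G.goodMembers 𝓑 v (θ * n)) {b : V} (hb : b ∈ B) (hvb : G.defect v b ≠ 0) :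
    ∃ Y : Finset V, (Y.card : ℝ) ≤ 4 * r ^ 2 * θ * n ∧
      ∀ y ∉ Y, G.defect b y ≤ G.defect v y := by
  obtain ⟨hB𝓑, hvB, hBnice⟩ := Finset.mem_filter.1 hB
  have hr1 : (1 : ℝ) ≤ r := by exact_mod_cast hr
  set 𝓟 := (B.filter fun p => G.defect v p ≠ 0).biUnion (G.atypical 𝓑) with h𝓟
  set 𝓠 := 𝓑.filter fun C => ∃ q ∈ C, q ∈ G.stuck 𝓑 ∧ G.defectTo q B ≠ 2 with h𝓠
  set 𝓔 := insert B (𝓟 ∪ 𝓠) with h𝓔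
  have h𝓔sub : 𝓔 ⊆ 𝓑 := by
    refine Finset.insert_subset hB𝓑 (Finset.union_subset ?_ (Finset.filter_subset _ _))
    exact Finset.biUnion_subset.2 fun p _ => Finset.filter_subset _ _
  refine ⟨(𝓑.biUnion id)ᶜ ∪ 𝓔.biUnion id, ?_, ?_⟩
  · have hP : (𝓟.card : ℝ) ≤ r * (5 * ε * n) := by
      have h1 : 𝓟.card ≤ ∑ p ∈ B.filter fun p => G.defect v p ≠ 0, (G.atypical 𝓑 p).card :=
        Finset.card_biUnion_le
      have h2 : ((∑ p ∈ B.filter fun p => G.defect v p ≠ 0, (G.atypical 𝓑 p).card : ℕ) : ℝ) ≤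
          (B.filter fun p => G.defect v p ≠ 0).card * (5 * ε * n) := by
        push_cast
        rw [← nsmul_eq_mul]
        refine Finset.sum_le_card_nsmul _ _ _ fun p hp => ?_
        obtain ⟨hp1, hp2⟩ := Finset.mem_filter.1 hp
        exact atypical_card_le hr hn0 h.disj hdeg hε hcov hεn
          (h.mem_stuck_of_defect hv hna hB𝓑 hvB hp1 hp2)
      refine ((Nat.cast_le.2 h1).trans h2).trans (mul_le_mul_of_nonneg_right ?_ (by positivity))
      rw [← h.card_eq B hB𝓑]
      exact Nat.cast_le.2 (Finset.card_filter_le _ _)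
    have hQ : (𝓠.card : ℝ) ≤ θ * n := by
      refine le_trans (Nat.cast_le.2 ?_) hBnice
      have hex : ∀ C ∈ 𝓠, ∃ q ∈ C, q ∈ G.stuck 𝓑 ∧ G.defectTo q B ≠ 2 := fun C hC =>
        (Finset.mem_filter.1 hC).2
      have : Nonempty V := ⟨v⟩
      choose! f hf using hex
      refine Finset.card_le_card_of_injOn f
        (fun C hC => Finset.mem_filter.2 ⟨(hf C hC).2.1, (hf C hC).2.2⟩) ?_
      intro C hC D hD hCD
      by_contra hne
      exact h.notMem (Finset.mem_filter.1 hC).1 (Finset.mem_filter.1 hD).1 hne (hf C hC).1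
        (hCD ▸ (hf D hD).1)
    have hE : 𝓔.card ≤ 𝓟.card + 𝓠.card + 1 :=
      (Finset.card_insert_le _ _).trans (Nat.add_le_add_right (Finset.card_union_le _ _) _)
    have hER : (𝓔.card : ℝ) ≤ 𝓟.card + 𝓠.card + 1 := by exact_mod_cast hE
    have hY := Finset.card_union_le (𝓑.biUnion id)ᶜ (𝓔.biUnion id)
    rw [h.card_biUnion h𝓔sub] at hY
    have hcompl := Finset.card_compl_add_card (𝓑.biUnion id)
    rw [h.card_biUnion subset_rfl] at hcompl
    have hYR : (((𝓑.biUnion id)ᶜ ∪ 𝓔.biUnion id).card : ℝ) ≤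
        (𝓑.biUnion id)ᶜ.card + 𝓔.card * r := by exact_mod_cast hY
    have hcomplR : ((𝓑.biUnion id)ᶜ.card : ℝ) + 𝓑.card * r = n := by
      rw [hn]
      exact_mod_cast hcompl
    have h1 : (𝓔.card : ℝ) * r ≤ (r * (5 * ε * n) + θ * n + 1) * r :=
      mul_le_mul_of_nonneg_right (by linarith) (by positivity)
    rw [hεθ] at h1
    have hθn : 0 < θ * n := by positivity
    have h2 : θ ^ 2 * n ≤ θ * n := by
      refine mul_le_mul_of_nonneg_right ?_ hn0.le
      nlinarith
    have h3 : (r : ℝ) ^ 2 * (θ ^ 2 * n) ≤ r ^ 2 * (θ * n) :=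
      mul_le_mul_of_nonneg_left h2 (by positivity)
    have h4 : (r : ℝ) * (θ * n) ≤ r ^ 2 * (θ * n) :=
      mul_le_mul_of_nonneg_right (by nlinarith) hθn.le
    have h5 : θ * n ≤ r * (θ * n) := le_mul_of_one_le_left hθn.le hr1
    have h6 : 2 * (ε * n) ≤ θ * n := by
      have : 5 * (ε * n) = θ ^ 2 * n := by rw [← hεθ]; ring
      linarith
    have h7 : (1 : ℝ) * r ≤ θ * n := by linarith
    nlinarith
  · intro y hy
    by_contra! hlt
    simp only [Finset.mem_union, Finset.mem_compl, not_or, not_not] at hy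
    obtain ⟨hy1, hy2⟩ := hy
    obtain ⟨C, hC, hyC⟩ := Finset.mem_biUnion.1 hy1
    simp only [id] at hyC
    have hCE : C ∉ 𝓔 := fun hCE => hy2 (Finset.mem_biUnion.2 ⟨C, hCE, hyC⟩)
    simp only [h𝓔, Finset.mem_insert, Finset.mem_union, not_or] at hCE
    obtain ⟨hCB, hCP, hCQ⟩ := hCE
    have hp : ∀ p ∈ B, G.defect v p ≠ 0 → G.defectTo p C = 2 := by
      intro p hpB hvp
      by_contra hne
      exact hCP (Finset.mem_biUnion.2 ⟨p, Finset.mem_filter.2 ⟨hpB, hvp⟩,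
        Finset.mem_filter.2 ⟨hC, hne⟩⟩)
    refine absurd hlt (not_lt.2 (h.defect_le_of_not_absorbs hv hna hB𝓑 hC (Ne.symm hCB) hb hyC hvb
      hvB hp fun q hq hbq => ?_))
    by_contra hne
    exact hCQ (Finset.mem_filter.2 ⟨hC, q, hq, h.mem_stuck_of_defect_of_defect hv hna hB𝓑 hC
      (Ne.symm hCB) hvB hb hvb (hp b hb hvb) hq hbq, hne⟩)

/-- Outside `Y` every disagreement costs `b` at least one unit of defect relative to `v`. Inside `Y`
the bound is 3, one for the disagreement and two for the defect. -/
lemma card_ne_le {b : V} {Y : Finset V} (hY : ∀ y ∉ Y, G.defect b y ≤ G.defect v y) :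
    (Finset.univ.filter fun y => G.defect b y ≠ G.defect v y).card + G.defectTo b Finset.univ ≤
      G.defectTo v Finset.univ + 3 * Y.card := by
  have h : ∑ y, ((if G.defect b y ≠ G.defect v y then 1 else 0) + G.defect b y) ≤
      ∑ y, (G.defect v y + 3 * if y ∈ Y then 1 else 0) := by
    refine Finset.sum_le_sum fun y _ => ?_
    have h1 := G.defect_le_two b y
    have h2 := hY y
    by_cases hy : y ∈ Y
    · split_ifs <;> omega
    · have h3 := h2 hy
      split_ifs <;> omega
  rw [Finset.sum_add_distrib, Finset.sum_add_distrib, ← Finset.card_filter, ← Finset.mul_sum,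
    ← Finset.card_filter] at h
  simpa [defectTo] using h

lemma IsTightFamily.absorbs (h : G.IsTightFamily r 𝓑) (hr : 0 < r)
    (hn : n = Fintype.card V) (hn0 : 0 < n)
    (hdeg : ∀ x, (G.defectTo x Finset.univ : ℝ) ≤ 2 * (1 / r + ε) * n) (hε : 0 < ε)
    (hcov : n - r * 𝓑.card ≤ ε * n) (hεn : 6 ≤ ε * n) (hθ : 0 < θ) (hθ1 : θ ≤ 1)
    (hεθ : 5 * ε = θ ^ 2) (hrθ : r ≤ θ * n) (hγ : 62 * r ^ 2 * θ < γ)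
    (hne : ¬ G.IsExtremal r γ) (hv : ∀ B ∈ 𝓑, v ∉ B) : G.Absorbs r 𝓑 v := by
  by_contra hna
  refine hne ?_
  have hr1 : (1 : ℝ) ≤ r := by exact_mod_cast hr
  have hvst := h.mem_stuck hv hna
  have hgood := goodMembers_card hr hn hn0 h.disj hdeg hε hcov hεn hθ hθ1 hεθ hvst
  have hlow := card_lower hr hn0 hε hcov
  set 𝓖 := G.goodMembers 𝓑 v (θ * n) with h𝓖
  have h𝓖sub : 𝓖 ⊆ 𝓑 := Finset.filter_subset _ _
  have hup : (𝓖.card : ℝ) ≤ n / r := by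
    rw [le_div_iff₀ (by positivity), hn]
    have h1 := h.card_biUnion h𝓖sub
    have h2 := Finset.card_le_univ (𝓖.biUnion id)
    rw [h1] at h2
    exact_mod_cast h2
  have h5ε : 5 * (ε * n) = θ ^ 2 * n := by rw [← hεθ]; ring
  have hθ2 : θ ^ 2 * n ≤ θ * n := by
    refine mul_le_mul_of_nonneg_right ?_ hn0.le
    nlinarith
  have hθn : 0 < θ * n := by positivity
  have hr2 : θ * n ≤ r ^ 2 * (θ * n) := le_mul_of_one_le_left hθn.le (by nlinarith)
  have hγn : 62 * r ^ 2 * θ * n < γ * n := mul_lt_mul_of_pos_right hγ hn0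
  set S := 𝓖.biUnion id with hS
  -- Since `z` is stuck, its total defect is at least about `2n/r`, while that of `v` is at most
  -- about `2n/r`. One-sided domination thus becomes near equality. Three times the bound on `Y`
  -- gives 12 of the 14, and the rest covers the errors.
  have hSmem : ∀ z ∈ S, G.defect v z ≠ 0 →
      ((Finset.univ.filter fun y => G.defect z y ≠ G.defect v y).card : ℝ) ≤
        (14 * r ^ 2 * θ) * n := by
    intro z hz hvz
    obtain ⟨B, hB, hzB⟩ := Finset.mem_biUnion.1 hz
    simp only [id] at hzB
    have hB' := Finset.mem_filter.1 hB
    obtain ⟨Y, hYc, hY⟩ := h.exists_exceptional hr hn hn0 hdeg hε hcov hεn hθ hθ1 hεθ hrθ hv hna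
      hB hzB hvz
    have hzst := h.mem_stuck_of_defect hv hna hB'.1 hB'.2.1 hzB hvz
    have h1 := card_ne_le hY
    have h2 := two_mul_card_le hzst
    have h3 := sum_defectTo_le (G := G) h.disj z
    have h4 : ((Finset.univ.filter fun y => G.defect z y ≠ G.defect v y).card : ℝ) + 2 * 𝓑.card ≤
        G.defectTo v Finset.univ + 3 * Y.card + 6 := by
      exact_mod_cast (by omega : (Finset.univ.filter fun y => G.defect z y ≠ G.defect v y).card +
        2 * 𝓑.card ≤ G.defectTo v Finset.univ + 3 * Y.card + 6)
    have h5 := hdeg v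
    have h6 : 2 * (1 / r + ε) * n = 2 * (n / r) + 2 * (ε * n) := by ring
    linarith
  refine isExtremal_of_uniform (κ := 14 * r ^ 2 * θ) (M := 𝓖.card) hn hn0 v
    (S.filter fun z => G.defect v z = 1) (S.filter fun z => G.defect v z = 2)
    (fun z hz => (Finset.mem_filter.1 hz).2) (fun z hz => (Finset.mem_filter.1 hz).2) ?_ ?_ ?_ ?_
    (by positivity)
  · intro z hz
    rcases Finset.mem_union.1 hz with hz | hz
    · obtain ⟨hz1, hz2⟩ := Finset.mem_filter.1 hz
      exact hSmem z hz1 (by omega)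
    · obtain ⟨hz1, hz2⟩ := Finset.mem_filter.1 hz
      exact hSmem z hz1 (by omega)
  · have h1 : ∑ z ∈ S, G.defect v z = ∑ B ∈ 𝓖, G.defectTo v B :=
      Finset.sum_biUnion fun B hB C hC hBC => h.disj (h𝓖sub hB) (h𝓖sub hC) hBC
    rw [Finset.sum_const_nat fun B (hB : B ∈ 𝓖) => (Finset.mem_filter.1 hB).2.1] at h1
    have h2 : ∑ z ∈ S, G.defect v z = (S.filter fun z => G.defect v z = 1).card +
        2 * (S.filter fun z => G.defect v z = 2).card := by
      rw [Finset.card_filter, Finset.card_filter, Finset.mul_sum, ← Finset.sum_add_distrib]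
      refine Finset.sum_congr rfl fun z _ => ?_
      have := G.defect_le_two v z
      split_ifs <;> omega
    have h3 := h2.symm.trans h1
    rw [mul_comm 𝓖.card] at h3
    exact_mod_cast h3
  · have habs : |(𝓖.card : ℝ) - n / r| ≤ 3 * (θ * n) := by
      rw [abs_le]
      constructor <;> linarith
    linarith
  · have : 0 < r ^ 2 * θ := by positivity
    linarith

end Absorption

/-! ### Tight families and repeated absorption. -/

section Iteration

variable {V : Type*} [DecidableEq V] {G : StdMultigraph V} {r : ℕ}

/-- Minimise the total cost among families of full cliques with the same number of members. The
vertices covered may change. -/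
lemma exists_isTightFamily [Fintype V] (hr : 0 < r) {F : Finset (Finset V)}
    (hd : (F : Set (Finset V)).PairwiseDisjoint id)
    (hF : ∀ T ∈ F, G.IsNearFull T ∧ T.card = r) :
    ∃ 𝓑, G.IsTightFamily r 𝓑 ∧ 𝓑.card = F.card := by
  classical
  obtain ⟨𝓑, h𝓑, hmin⟩ := Finset.exists_min_image
    (Finset.univ.filter fun 𝓑 : Finset (Finset V) => (𝓑 : Set (Finset V)).PairwiseDisjoint id ∧
      (∀ T ∈ 𝓑, G.IsNearFull T ∧ T.card = r) ∧ 𝓑.card = F.card) (fun 𝓑 => ∑ B ∈ 𝓑, G.cost B)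
    ⟨F, by simpa using ⟨hd, hF⟩⟩
  simp only [Finset.mem_filter, Finset.mem_univ, true_and, and_imp] at h𝓑 hmin
  obtain ⟨h1, h2, h3⟩ := h𝓑
  refine ⟨𝓑, ⟨h1, fun B hB => (h2 B hB).1, fun B hB => (h2 B hB).2, ?_⟩, h3⟩
  intro B hB C hC hBC B' C' hB' hC' hBr hCr hdis hun
  have hB0 : B'.Nonempty := by rw [← Finset.card_pos]; omega
  have hC0 : C'.Nonempty := by rw [← Finset.card_pos]; omega
  have hfam : G.IsFamily r 𝓑 := ⟨h1, fun T hT => (h2 T hT).1, fun T hT => by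
    rw [← Finset.card_pos]; have := (h2 T hT).2; omega, fun T hT => (h2 T hT).2.le⟩
  have hR : ({B, C} : Finset (Finset V)) ⊆ 𝓑 := by
    intro S hS
    rcases Finset.mem_insert.1 hS with rfl | hS
    · exact hB
    · rwa [Finset.mem_singleton.1 hS]
  have hne : B' ≠ C' := by
    rintro rfl
    rw [disjoint_self] at hdis
    exact hB0.ne_empty hdis
  obtain ⟨hnew, hdn⟩ := hfam.exchange
    (isFamily_pair hB' hB0 hBr.le hC' hC0 hCr.le hdis) (R := {B, C}) (by
      intro S hS T hT
      refine hfam.disjoint_of_subset hR hS fun x hx => ?_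
      have hx' : x ∈ B ∪ C := by
        rw [← hun]
        rcases Finset.mem_insert.1 hT with rfl | hT
        · exact Finset.mem_union_left _ hx
        · rw [Finset.mem_singleton.1 hT] at hx
          exact Finset.mem_union_right _ hx
      rcases Finset.mem_union.1 hx' with h | h
      · exact ⟨B, by simp, h⟩
      · exact ⟨C, by simp, h⟩)
  have hmin' := hmin _ hnew.disj (fun T hT => by
    refine ⟨hnew.nearFull T hT, ?_⟩
    rcases Finset.mem_union.1 hT with hT | hT
    · exact (h2 T (Finset.mem_sdiff.1 hT).1).2
    · rcases Finset.mem_insert.1 hT with rfl | hT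
      · exact hBr
      · rwa [Finset.mem_singleton.1 hT]) (by
    have e := Finset.card_sdiff_add_card_eq_card hR
    rw [Finset.card_union_of_disjoint hdn, Finset.card_pair hne, ← h3, ← e, Finset.card_pair hBC])
  rw [Finset.sum_union hdn, ← Finset.sum_sdiff hR, Finset.sum_pair hne, Finset.sum_pair hBC] at hmin'
  exact Nat.le_of_add_le_add_left hmin'

/-- Vertices are absorbed one at a time into members not yet used. Each uses at most three, so
absorption need only survive the deletion of `3 * U.card` members. -/
lemma IsTightFamily.absorb_all {𝓑 : Finset (Finset V)} (h : G.IsTightFamily r 𝓑) (U : Finset V)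
    (hU : ∀ v ∈ U, ∀ B ∈ 𝓑, v ∉ B)
    (habs : ∀ v ∈ U, ∀ 𝓒 ⊆ 𝓑, 𝓒.card ≤ 3 * U.card → G.Absorbs r (𝓑 \ 𝓒) v) :
    ∃ 𝓒 ⊆ 𝓑, 𝓒.card ≤ 3 * U.card ∧ ∃ 𝓣 : Finset (Finset V),
      (𝓣 : Set (Finset V)).PairwiseDisjoint id ∧
      (∀ T ∈ 𝓣, G.IsPathClique T ∧ (T.card = r ∨ T.card = r + 1)) ∧
      𝓣.biUnion id = U ∪ 𝓒.biUnion id := by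
  induction U using Finset.induction_on with
  | empty => exact ⟨∅, by simp, by simp, ∅, by simp, by simp, by simp⟩
  | insert v U hvU ih =>
    rw [Finset.card_insert_of_notMem hvU] at habs ⊢
    obtain ⟨𝓒₁, hs₁, hc₁, 𝓣₁, hd₁, hT₁, hun₁⟩ := ih
      (fun u hu => hU u (Finset.mem_insert_of_mem hu))
      (fun u hu 𝓒 hs hc => habs u (Finset.mem_insert_of_mem hu) 𝓒 hs (by omega))
    obtain ⟨𝓒₂, hs₂, hc₂, 𝓣₂, hd₂, hT₂, hun₂⟩ :=
      habs v (Finset.mem_insert_self _ _) 𝓒₁ hs₁ (by omega)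
    have hs₂' : 𝓒₂ ⊆ 𝓑 := hs₂.trans Finset.sdiff_subset
    have hdisj : Disjoint (𝓣₁.biUnion id) (𝓣₂.biUnion id) := by
      rw [hun₁, hun₂, Finset.disjoint_left]
      intro x hx hx'
      simp only [Finset.mem_union, Finset.mem_insert, Finset.mem_biUnion, id] at hx hx'
      rcases hx with hx | ⟨B, hB, hxB⟩ <;> rcases hx' with rfl | ⟨C, hC, hxC⟩
      · exact hvU hx
      · exact hU x (Finset.mem_insert_of_mem hx) C (hs₂' hC) hxC
      · exact hU x (Finset.mem_insert_self _ _) B (hs₁ hB) hxB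
      · have hne : B ≠ C := by
          rintro rfl
          exact (Finset.mem_sdiff.1 (hs₂ hC)).2 hB
        exact h.notMem (hs₁ hB) (hs₂' hC) hne hxB hxC
    refine ⟨𝓒₁ ∪ 𝓒₂, Finset.union_subset hs₁ hs₂', (Finset.card_union_le _ _).trans (by omega),
      𝓣₁ ∪ 𝓣₂, ?_, ?_, ?_⟩
    · intro S hS T hT hST
      simp only [Finset.coe_union, Set.mem_union, Finset.mem_coe] at hS hT
      rcases hS with hS | hS <;> rcases hT with hT | hT
      · exact hd₁ hS hT hST
      · exact hdisj.mono (Finset.subset_biUnion_of_mem id hS) (Finset.subset_biUnion_of_mem id hT)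
      · exact (hdisj.mono (Finset.subset_biUnion_of_mem id hT)
          (Finset.subset_biUnion_of_mem id hS)).symm
      · exact hd₂ hS hT hST
    · intro T hT
      rcases Finset.mem_union.1 hT with hT | hT
      exacts [hT₁ T hT, hT₂ T hT]
    · rw [Finset.union_biUnion, hun₁, hun₂, Finset.union_biUnion]
      ext x
      simp only [Finset.mem_union, Finset.mem_insert]
      tauto

end Iteration

/-! ### Choice of constants and assembly. -/

section Main

lemma IsExtremal.mono {V : Type*} [Fintype V] {G : StdMultigraph V} {r : ℕ} {γ γ' : ℝ}
    (h : G.IsExtremal r γ) (hγ : γ ≤ γ') : G.IsExtremal r γ' := by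
  have h1 : γ * (Fintype.card V : ℝ) ≤ γ' * Fintype.card V :=
    mul_le_mul_of_nonneg_right hγ (by positivity)
  have h2 : γ * (Fintype.card V : ℝ) ^ 2 ≤ γ' * (Fintype.card V : ℝ) ^ 2 :=
    mul_le_mul_of_nonneg_right hγ (by positivity)
  exact h.imp (fun ⟨S, a, b⟩ => ⟨S, a.trans_le h1, b.trans_le h2⟩)
    (fun ⟨S, a, b⟩ => ⟨S, a.trans_le h1, b.trans_le h2⟩)

universe u

theorem exists_threshold (r : ℕ) (hr : 0 < r) (γ : ℝ) (hγ : 0 < γ) :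
    ∃ η₀ : ℝ, 0 < η₀ ∧ ∃ n₀ : ℕ, ∀ (V : Type u) [Fintype V] (G : StdMultigraph V),
      n₀ ≤ Fintype.card V → ¬ G.IsExtremal r γ →
      2 * (1 - 1 / (r : ℝ) - η₀) * (Fintype.card V : ℝ) ≤ (G.minDegree : ℝ) →
      G.HasPerfectTiling (KPrime r ∪ KPrime (r + 1)) := by
  have hr1 : (1 : ℝ) ≤ r := by exact_mod_cast hr
  set γ' := min γ 1 with hγ'
  have hγ'0 : 0 < γ' := lt_min hγ one_pos
  set θ := γ' / (100 * (r : ℝ) ^ 2) with hθdef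
  have hθ : 0 < θ := by positivity
  have hθr : 100 * (r : ℝ) ^ 2 * θ = γ' := by
    rw [hθdef]
    field_simp
  have hr2 : (1 : ℝ) ≤ (r : ℝ) ^ 2 := by nlinarith
  have hθ1 : θ ≤ 1 := by
    have := min_le_right γ 1
    nlinarith
  set ε := θ ^ 2 / 5 with hεdef
  have hε : 0 < ε := by positivity
  set C := leftoverConst r (4 * (r + 1) * r + 1) with hC
  have hC0 : 0 ≤ C := leftoverConst_nonneg _ _
  -- At most `C * η * n` vertices are uncovered, and absorbing them spoils up to `3 * r` vertices
  -- each. The factor `1 + 3 * r` keeps the total within `ε * n`.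
  set η := ε / ((1 + 3 * r) * (C + 1)) with hηdef
  have hη : 0 < η := by positivity
  have hηC : (1 + 3 * r) * (C * η) ≤ ε := by
    have : (1 + 3 * r) * (C + 1) * η = ε := by
      rw [hηdef]
      field_simp
    nlinarith
  have hηε : η ≤ ε := div_le_self hε.le (by nlinarith)
  refine ⟨η, hη, ⌈r / η ^ 2 + 6 / ε + r / θ + 1⌉₊, fun V _ G hn hne hdeg => ?_⟩
  classical
  obtain ⟨n, hnV⟩ : ∃ n : ℝ, n = Fintype.card V := ⟨_, rfl⟩
  have hn1 : r / η ^ 2 + 6 / ε + r / θ + 1 ≤ n := hnV ▸ Nat.ceil_le.1 hn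
  have p1 : 0 ≤ r / η ^ 2 := by positivity
  have p2 : 0 ≤ 6 / ε := by positivity
  have p3 : 0 ≤ r / θ := by positivity
  have hn0 : 0 < n := by linarith
  have hεn : 6 ≤ ε * n := by
    rw [mul_comm, ← div_le_iff₀ hε]
    linarith
  have hrθ : r ≤ θ * n := by
    rw [mul_comm, ← div_le_iff₀ hθ]
    linarith
  have hdef : ∀ x, (G.defectTo x Finset.univ : ℝ) ≤ 2 * (1 / r + η) * n := by
    intro x
    have h1 : (G.defectTo x Finset.univ : ℝ) + G.degree x = 2 * n := by
      rw [hnV]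
      exact_mod_cast G.defectTo_univ_add_degree x
    have h2 : (G.minDegree : ℝ) ≤ G.degree x := by exact_mod_cast G.minDegree_le_degree x
    rw [← hnV] at hdeg
    linarith
  obtain ⟨F, hFd, hF, hFc⟩ := exists_almost_tiling hr hη (hnV ▸ hdef) (hnV ▸ (by linarith))
  obtain ⟨𝓑, h𝓑, hcard⟩ := exists_isTightFamily hr hFd hF
  rw [← hcard, ← hnV] at hFc
  set U := (𝓑.biUnion id)ᶜ with hU
  have hUmem : ∀ v ∈ U, ∀ B ∈ 𝓑, v ∉ B := by
    intro v hv B hB hvB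
    exact (Finset.mem_compl.1 hv) (Finset.mem_biUnion.2 ⟨B, hB, hvB⟩)
  have hUcard : (U.card : ℝ) = n - r * 𝓑.card := by
    have h1 := Finset.card_compl_add_card (𝓑.biUnion id)
    rw [h𝓑.card_biUnion subset_rfl] at h1
    have h2 : (U.card : ℝ) + 𝓑.card * r = n := by
      rw [hnV]
      exact_mod_cast h1
    linarith
  obtain ⟨𝓒, hs, -, 𝓣, hd, hT, hun⟩ := h𝓑.absorb_all U hUmem (by
    intro v hv 𝓒 hs hc
    refine (h𝓑.subset Finset.sdiff_subset).absorbs hr hnV hn0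
      (fun x => (hdef x).trans ?_) hε ?_ hεn hθ hθ1 (by rw [hεdef]; ring) hrθ ?_ hne
      (fun B hB => hUmem v hv B (Finset.mem_sdiff.1 hB).1)
    · gcongr
    · have h1 := Finset.card_sdiff_add_card_eq_card hs
      have h2 : ((𝓑 \ 𝓒).card : ℝ) + 𝓒.card = 𝓑.card := by exact_mod_cast h1
      have h3 : (𝓒.card : ℝ) ≤ 3 * U.card := by exact_mod_cast hc
      have h4 : (r : ℝ) * 𝓒.card ≤ r * (3 * U.card) := mul_le_mul_of_nonneg_left h3 (by positivity)
      have h5 : (1 + 3 * r) * (U.card : ℝ) ≤ (1 + 3 * r) * (C * η * n) :=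
        mul_le_mul_of_nonneg_left (by linarith) (by positivity)
      have h6 : (1 + 3 * r) * (C * η) * n ≤ ε * n := mul_le_mul_of_nonneg_right hηC hn0.le
      nlinarith
    · have := min_le_left γ 1
      linarith)
  have hdisj : ∀ T ∈ 𝓣, ∀ B ∈ 𝓑 \ 𝓒, Disjoint T B := by
    intro T hT B hB
    obtain ⟨hB1, hB2⟩ := Finset.mem_sdiff.1 hB
    rw [Finset.disjoint_left]
    intro x hxT hxB
    have hx : x ∈ 𝓣.biUnion id := Finset.mem_biUnion.2 ⟨T, hT, hxT⟩
    rw [hun] at hx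
    rcases Finset.mem_union.1 hx with hx | hx
    · exact hUmem x hx B hB1 hxB
    · obtain ⟨D, hD, hxD⟩ := Finset.mem_biUnion.1 hx
      have hne : D ≠ B := fun e => hB2 (e ▸ hD)
      exact h𝓑.notMem (hs hD) hB1 hne hxD hxB
  refine hasPerfectTiling_of_cliques hr Set.subset_union_left Set.subset_union_right
    (𝓣 ∪ 𝓑 \ 𝓒) ?_ ?_ ?_
  · intro S hS T hT hST
    simp only [Finset.coe_union, Set.mem_union, Finset.mem_coe] at hS hT
    rcases hS with hS | hS <;> rcases hT with hT | hT
    · exact hd hS hT hST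
    · exact hdisj S hS T hT
    · exact (hdisj T hT S hS).symm
    · exact h𝓑.disj (Finset.mem_sdiff.1 hS).1 (Finset.mem_sdiff.1 hT).1 hST
  · intro T hT'
    rcases Finset.mem_union.1 hT' with hT' | hT'
    · exact hT T hT'
    · have hT1 := (Finset.mem_sdiff.1 hT').1
      exact ⟨(h𝓑.nearFull T hT1).isPathClique, Or.inl (h𝓑.card_eq T hT1)⟩
  · intro v
    by_cases hv : v ∈ 𝓣.biUnion id
    · obtain ⟨T, hT, hvT⟩ := Finset.mem_biUnion.1 hv
      exact ⟨T, Finset.mem_union_left _ hT, hvT⟩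
    · rw [hun, Finset.mem_union, not_or] at hv
      have hvB : v ∈ 𝓑.biUnion id := by
        by_contra hcon
        exact hv.1 (Finset.mem_compl.2 hcon)
      obtain ⟨B, hB, hvB⟩ := Finset.mem_biUnion.1 hvB
      refine ⟨B, Finset.mem_union_right _ (Finset.mem_sdiff.2 ⟨hB, fun hBC => hv.2 ?_⟩), hvB⟩
      exact Finset.mem_biUnion.2 ⟨B, hBC, hvB⟩

/-- Any positive sequence admits a strictly increasing positive function below it. -/
lemma exists_strictMonoOn_le (a : ℕ → ℝ) (ha : ∀ N, 0 < a N) :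
    ∃ g : ℝ → ℝ, StrictMonoOn g (Set.Ioi 0) ∧ (∀ x, 0 < x → 0 < g x) ∧
      (∀ x, 0 < x → g x ≤ x) ∧ ∀ x, 0 < x → ∀ N ≤ ⌈1 / x⌉₊, g x ≤ a N := by
  let b : ℕ → ℝ := fun N => min 1 ((Finset.range (N + 1)).inf' ⟨0, by simp⟩ a)
  have hb0 : ∀ N, 0 < b N := fun N =>
    lt_min one_pos ((Finset.lt_inf'_iff _).2 fun i _ => ha i)
  have hb1 : ∀ N, b N ≤ 1 := fun N => min_le_left _ _
  have hba : ∀ N M, M ≤ N → b N ≤ a M := fun N M h =>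
    (min_le_right _ _).trans (Finset.inf'_le _ (by simpa [Nat.lt_succ_iff] using h))
  have hbanti : ∀ N M, M ≤ N → b N ≤ b M := fun N M h =>
    min_le_min_left _ (Finset.inf'_mono _ (Finset.range_mono (by omega)) _)
  have hq0 : ∀ x : ℝ, 0 < x → 0 < x / (1 + x) := fun x hx => by positivity
  have hq1 : ∀ x : ℝ, 0 < x → x / (1 + x) ≤ 1 := fun x hx => by
    rw [div_le_one (by positivity)]; linarith
  have hqx : ∀ x : ℝ, 0 < x → x / (1 + x) ≤ x := fun x hx => div_le_self hx.le (by linarith)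
  -- The antitone minorant `b` yields a weakly increasing step function. The factor `x / (1 + x)`
  -- makes it strict and keeps the value below `x`.
  refine ⟨fun x => b ⌈1 / x⌉₊ * (x / (1 + x)), ?_, ?_, ?_, ?_⟩
  · intro x hx y hy hxy
    have hx' : 0 < x := hx
    have hy' : 0 < y := hy
    have h1 : ⌈1 / y⌉₊ ≤ ⌈1 / x⌉₊ := Nat.ceil_le_ceil (one_div_le_one_div_of_le hx' hxy.le)
    have h2 : x / (1 + x) < y / (1 + y) := by
      rw [div_lt_div_iff₀ (by positivity) (by positivity)]
      linarith
    exact mul_lt_mul' (hbanti _ _ h1) h2 (hq0 x hx').le (hb0 _)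
  · exact fun x hx => mul_pos (hb0 _) (hq0 x hx)
  · exact fun x hx => (mul_le_of_le_one_left (hq0 x hx).le (hb1 _)).trans (hqx x hx)
  · exact fun x hx N hN => (mul_le_of_le_one_right (hb0 _).le (hq1 x hx)).trans (hba _ _ hN)

end Main

end StdMultigraph

theorem mainTheorem8 :
    ∃ f g h : ℝ → ℝ,
      (StrictMonoOn f (Set.Ioi 0) ∧ ∀ x, 0 < x → 0 < f x) ∧
      (StrictMonoOn g (Set.Ioi 0) ∧ ∀ x, 0 < x → 0 < g x) ∧
      (StrictMonoOn h (Set.Ioi 0) ∧ ∀ x, 0 < x → 0 < h x) ∧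
      ∀ (n r : ℕ) (η γ : ℝ), 2 ≤ r →
        0 < γ → γ ≤ f (1 / (r : ℝ)) →
        0 < η → η ≤ g γ →
        0 < 1 / (n : ℝ) → 1 / (n : ℝ) ≤ h η →
        ∀ (V : Type*) [Fintype V] (G : StdMultigraph V), Fintype.card V = n →
          ¬ G.IsExtremal r γ →
          2 * (1 - 1 / (r : ℝ) - η) * (n : ℝ) ≤ (G.minDegree : ℝ) →
          G.HasPerfectTiling (StdMultigraph.KPrime r ∪ StdMultigraph.KPrime (r + 1)) := by
  have hthr := fun N r : ℕ => StdMultigraph.exists_threshold (r + 1) r.succ_pos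
    (1 / ((N : ℝ) + 1)) (by positivity)
  choose η₀ hη₀ n₀ hn₀ using hthr
  obtain ⟨g, hg, hg0, hgx, hga⟩ := StdMultigraph.exists_strictMonoOn_le
    (fun N => (Finset.range (N + 1)).inf' ⟨0, by simp⟩ (η₀ N))
    (fun N => (Finset.lt_inf'_iff _).2 fun i _ => hη₀ N i)
  obtain ⟨h, hh, hh0, -, hha⟩ := StdMultigraph.exists_strictMonoOn_le
    (fun N => (Finset.range (N + 1)).inf' ⟨0, by simp⟩ fun r => 1 / ((n₀ N r : ℝ) + 1))
    (fun N => (Finset.lt_inf'_iff _).2 fun i _ => by positivity)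
  -- With `f = id` the condition `γ ≤ 1 / r` bounds `r` by `1 / γ`, so only finitely many `r`
  -- compete for each `γ`. Rounding `γ` down to `1 / (N + 1)` leaves countably many thresholds. As
  -- `g γ ≤ γ`, the number `⌈1 / η⌉₊` bounds `N` and thereby also `r`.
  refine ⟨id, g, h, ⟨strictMono_id.strictMonoOn _, fun x hx => hx⟩, ⟨hg, hg0⟩, ⟨hh, hh0⟩, ?_⟩
  intro n r η γ hr hγ hγr hη hηγ hn hnη V _ G hV hne hdeg
  obtain ⟨r, rfl⟩ : ∃ s, r = s + 1 := ⟨r - 1, by omega⟩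
  set N := ⌈1 / γ⌉₊ with hN
  have hNγ : 1 / γ ≤ N := Nat.le_ceil _
  have hrN : r < N + 1 := by
    have h1 : ((r + 1 : ℕ) : ℝ) ≤ 1 / γ := (le_one_div (by positivity) hγ).2 hγr
    have h2 : r + 1 ≤ N := by exact_mod_cast h1.trans hNγ
    omega
  have hγN : 1 / ((N : ℝ) + 1) ≤ γ := (one_div_le (by positivity) hγ).2 (by linarith)
  have hηN : η ≤ η₀ N r :=
    (hηγ.trans (hga γ hγ N le_rfl)).trans (Finset.inf'_le _ (Finset.mem_range.2 hrN))
  have hNη : N ≤ ⌈1 / η⌉₊ :=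
    Nat.ceil_le_ceil (one_div_le_one_div_of_le hη (hηγ.trans (hgx γ hγ)))
  have hnN : 1 / (n : ℝ) ≤ 1 / ((n₀ N r : ℝ) + 1) :=
    (hnη.trans (hha η hη N hNη)).trans (Finset.inf'_le _ (Finset.mem_range.2 hrN))
  have hn0 : n₀ N r ≤ n := by
    have h1 : (n₀ N r : ℝ) + 1 ≤ n :=
      (one_div_le_one_div (one_div_pos.1 hn) (by positivity)).1 hnN
    exact_mod_cast (by linarith : (n₀ N r : ℝ) ≤ n)
  refine hn₀ N r V G (hV ▸ hn0) (fun hext => hne (hext.mono hγN)) (le_trans ?_ hdeg)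
  rw [hV]
  gcongr
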